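/- Let $k'>k\ge 3$ be integers and $\lambda,\mu>0$. Let $\mathbb S$ be the space of real symmetric $2\times2$ matrices, $A:B=\sum_{i,j}A_{ij}B_{ij}$, and $\mathcal A\sigma=\frac1{2\mu}\bigl(\sigma-\frac{\lambda}{2\mu+2\lambda}\mathrm{tr}(\sigma)I\bigr)$. For a triangle $K$ with barycentric coordinates $\lambda_1,\lambda_2,\lambda_3$ put $b=\lambda_1\lambda_2\lambda_3$ and $P_{k,k'}(K)=P_k(K)+bP_{k'-3}(K)$. Fix a $P_{k,k'}$-Lagrange element with a quadrature rule on its nodes: finitely many nodes $\chi_1,\dots,\chi_r$ in the closed triangle, given by barycentric coordinates that are the same for all triangles $K$, such that a function in $P_{k,k'}(K)$ is uniquely determined by arbitrarily prescribed nodal values, and weights $w_i=\operatorname{meas}(K)\,\omega_i$ with $\omega_i$ independent of $K$, such that $\sum_i w_i=\operatorname{meas}(K)$, all $w_i>0$, and the rule $I_{k,k',K}(f)=\sum_i w_if(\chi_i)\approx\int_K f\,dx$ is exact for polynomials of degree at most $k+k'-2$. Let $\Omega\subset\mathbb R^2$ be a bounded polygonal region, and let $\mathcal T_h$ be a conforming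 triangulation of $\Omega$, i.e. a finite set of nondegenerate closed triangles with union $\overline\Omega$, two distinct ones being disjoint or meeting exactly in a common vertex or a common edge. Write $(\cdot,\cdot)$ and $\|\cdot\|_0$ for the $L^2(\Omega)$ inner product and norm, $\operatorname{div}$ for the row-wise weak divergence, $H(\operatorname{div},\Omega;\mathbb S)$ for the symmetric $L^2$ matrix fields with divergence in $L^2$, $P_m(K;X)$ for the $X$-valued polynomials of degree at most $m$, and $P_i^{\mathrm{hom}}(K;\mathbb S)$ for the homogeneous ones of degree $i$. Define $$\widetilde\Sigma_{k,h}=\{\tau\in H^1(\Omega;\mathbb S):\tau|_K\in P_k(K;\mathbb S)\ \forall K\in\mathcal T_h\},$$ $$B_{k,h}=\{\tau\in H(\operatorname{div},\Omega;\mathbb S):\tau|_K\in P_k(K;\mathbb S),\ \tau|_K\,\nu|_{\partial K}=0\ \forall K\in\mathcal T_h\},$$ where $\nu$ is the normal along $\partial K$, $$\Lambda_{k,k'}=\Bigl\{\tau\in H(\operatorname{div},\Omega;\mathbb S):\tau|_K\in\sum_{i=k-2}^{k'-3}b\,P_i^{\mathrm{hom}}(K;\mathbb S)\ \forall K\in\mathcal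 T_h\Bigr\},$$ $$\Sigma_{k,k',h}=\widetilde\Sigma_{k,h}+B_{k,h}+\Lambda_{k,k'},\qquad V_{k,k',h}=\{v\in L^2(\Omega;\mathbb R^2):v|_K\in P_{k-1}(K;\mathbb R^2)\ \forall K\in\mathcal T_h\}+\operatorname{div}\Lambda_{k,k'},$$ and $(\mathcal A\sigma,\tau)_h=\sum_{K\in\mathcal T_h}I_{k,k',K}(\mathcal A\sigma|_K:\tau|_K)$ for $\sigma,\tau\in\Sigma_{k,k',h}$, where on each $K$ the nodal values are those of the polynomials $\sigma|_K,\tau|_K$. 1. There is a constant $C>0$, depending only on $\lambda,\mu$ and the chosen element and quadrature rule (in particular not on $\Omega$, the triangulation or $h$), such that for all such $\Omega$ and $\mathcal T_h$ $$(\mathcal A\tau,\tau)_h\ \ge\ C\,\|\tau\|_0^2\qquad\forall\,\tau\in\Sigma_{k,k',h}.$$ 2. For all such $\Omega$ and $\mathcal T_h$ and every $f\in L^2(\Omega;\mathbb R^2)$, the mass-lumped scheme: find $(\sigma_h,u_h)\in\Sigma_{k,k',h}\times V_{k,k',h}$ such that $$(\mathcal A\sigma_h,\tau_h)_h+(\operatorname{div}\tau_h,u_h)=0\quad\forall\tau_h\in\Sigma_{k,k',h},\qquad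 -(\operatorname{div}\sigma_h,v_h)=(f,v_h)\quad\forall v_h\in V_{k,k',h},$$ has exactly one solution. -/

import Mathlib

open MeasureTheory Set
open scoped ContDiff Matrix

noncomputable section

namespace LumpedElasticity

/-! ### Points, polynomials, triangles -/

/-- The plane `ℝ²`. -/
abbrev Plane := EuclideanSpace ℝ (Fin 2)

/-- Real polynomials in the two Cartesian coordinates. -/
abbrev Poly := MvPolynomial (Fin 2) ℝ

/-- The value of a polynomial at a point of the plane. -/
def pval (p : Poly) (x : Plane) : ℝ := MvPolynomial.eval (fun i => x i) p

/-- The value of a matrix of polynomials at a point. -/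
def mval (τ : Matrix (Fin 2) (Fin 2) Poly) (x : Plane) : Matrix (Fin 2) (Fin 2) ℝ :=
  Matrix.of fun i j => pval (τ i j) x

/-- Nondegenerate triangles (three affinely independent vertices `K.points 0, 1, 2`). -/
abbrev Triangle := Affine.Simplex ℝ Plane 2

/-- The closed triangle as a set of points. -/
def Triangle.body (K : Triangle) : Set Plane := convexHull ℝ (Set.range K.points)

/-- The area of a triangle. -/
def Triangle.area (K : Triangle) : ℝ := volume.real K.body

/-- The point of `K` with barycentric coordinates `α`. -/
def Triangle.pointOf (K : Triangle) (α : Fin 3 → ℝ) : Plane := ∑ j, α j • K.points j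

/-- The barycentric coordinate function of `K` that belongs to the vertex `K.points j`, as a
polynomial: `det (p - x, q - x) / det (p - a, q - a)` with `a = K.points j` and `p, q` the two
other vertices (indices are modulo 3). -/
def Triangle.bary (K : Triangle) (j : Fin 3) : Poly :=
  let a := K.points j
  let p := K.points (j + 1)
  let q := K.points (j + 2)
  MvPolynomial.C ((p 0 - a 0) * (q 1 - a 1) - (p 1 - a 1) * (q 0 - a 0))⁻¹ *
    ((MvPolynomial.C (p 0) - MvPolynomial.X 0) * (MvPolynomial.C (q 1) - MvPolynomial.X 1)
      - (MvPolynomial.C (p 1) - MvPolynomial.X 1) * (MvPolynomial.C (q 0) - MvPolynomial.X 0))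

/-- The cubic bubble function `b = λ₁ λ₂ λ₃` of `K`. -/
def Triangle.bubble (K : Triangle) : Poly := K.bary 0 * K.bary 1 * K.bary 2

/-- The reference triangle with vertices `(0,0)`, `(1,0)`, `(0,1)`. -/
def refTriangle : Triangle where
  points := ![!₂[0, 0], !₂[1, 0], !₂[0, 1]]
  independent := by
    rw [affineIndependent_iff_linearIndependent_vsub ℝ _ (0 : Fin 3), Fintype.linearIndependent_iff]
    intro g hg i
    have hu : (Finset.univ : Finset {x : Fin 3 // x ≠ 0}) = {⟨1, by decide⟩, ⟨2, by decide⟩} := by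
      decide
    rw [hu, Finset.sum_pair (by decide)] at hg
    have e0 := congrArg (fun v : Plane => v 0) hg
    have e1 := congrArg (fun v : Plane => v 1) hg
    simp at e0 e1
    obtain ⟨i, hne⟩ := i
    fin_cases i
    · simp at hne
    · exact e0
    · exact e1

/-! ### The local space `P_{k,k'}` and mass-lumping quadrature rules -/

/-- `P_{k,k'}(K) = P_k(K) + b P_{k'-3}(K)`. -/
def Pkk (k k' : ℕ) (K : Triangle) : Set Poly :=
  {p | ∃ q s : Poly, q.totalDegree ≤ k ∧ s.totalDegree ≤ k' - 3 ∧ p = q + K.bubble * s}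

/-- A `P_{k,k'}`-Lagrange element together with the quadrature rule supported on its nodes, given
in barycentric coordinates.  On a triangle `K` the nodes are the points with barycentric
coordinates `node i` and the weights are `w_i = area K * weight i`.  The Lagrange property and the
degree of exactness are imposed on the reference triangle. -/
structure LumpingRule (k k' : ℕ) where
  /-- the number of nodes -/
  r : ℕ
  /-- barycentric coordinates of the nodes -/
  node : Fin r → Fin 3 → ℝ
  /-- weights relative to the area -/
  weight : Fin r → ℝ
  node_nonneg : ∀ i j, 0 ≤ node i j
  node_sum : ∀ i, ∑ j, node i j = 1
  /-- `P_{k,k'}`-functions are uniquely determined by arbitrary nodal values. -/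
  unisolvent : ∀ y : Fin r → ℝ,
    ∃! p : Poly, p ∈ Pkk k k' refTriangle ∧ ∀ i, pval p (refTriangle.pointOf (node i)) = y i
  /-- the weights on `K` add up to the area of `K` -/
  weight_sum : ∑ i, weight i = 1
  /-- the weights are strictly positive -/
  weight_pos : ∀ i, 0 < weight i
  /-- the rule is exact for polynomials of degree at most `k + k' - 2` -/
  exact : ∀ p : Poly, p.totalDegree ≤ k + k' - 2 →
    ∫ x in refTriangle.body, pval p x =
      refTriangle.area * ∑ i, weight i * pval p (refTriangle.pointOf (node i))

/-- The quadrature operator `I_{k,k',K}`, `f ↦ ∑ w_i f(χ_i)`. -/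
def LumpingRule.quad {k k' : ℕ} (Q : LumpingRule k k') (K : Triangle) (f : Plane → ℝ) : ℝ :=
  ∑ i, (K.area * Q.weight i) * f (K.pointOf (Q.node i))

/-! ### Domains and conforming triangulations -/

/-- Bounded polygonal regions: bounded open sets that lie locally on one side of their boundary,
the boundary being a finite union of line segments. (Connectedness is not needed.) -/
structure IsPolygonal (Ω : Set Plane) : Prop where
  isOpen : IsOpen Ω
  bounded : Bornology.IsBounded Ω
  regular : interior (closure Ω) = Ω
  frontier_eq : ∃ S : Finset (Plane × Plane), frontier Ω = ⋃ e ∈ S, segment ℝ e.1 e.2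

/-- Conforming triangulations of `Ω`: finitely many triangles that cover the closure of `Ω`, any
two distinct ones being disjoint or meeting exactly in a common vertex or in a common edge. -/
structure Triangulation (Ω : Set Plane) where
  cells : Finset Triangle
  cover : ⋃ K ∈ cells, K.body = closure Ω
  conforming : ∀ K ∈ cells, ∀ L ∈ cells, K ≠ L →
    K.body ∩ L.body = ∅ ∨
    (∃ i j, K.points i = L.points j ∧ K.body ∩ L.body = {K.points i}) ∨
    (∃ i i' j j', i ≠ i' ∧ K.points i = L.points j ∧ K.points i' = L.points j' ∧
      K.body ∩ L.body = segment ℝ (K.points i) (K.points i'))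

/-! ### Sobolev spaces through weak derivatives -/

/-- Test functions `C_c^∞(Ω)`. -/
def IsTest (Ω : Set Plane) (φ : Plane → ℝ) : Prop :=
  ContDiff ℝ ∞ φ ∧ HasCompactSupport φ ∧ tsupport φ ⊆ Ω

/-- The classical partial derivative in the direction of the `j`-th coordinate. -/
def pderiv (j : Fin 2) (φ : Plane → ℝ) (x : Plane) : ℝ :=
  fderiv ℝ φ x (EuclideanSpace.single j 1)

/-- `u ∈ L²(Ω)`. -/
def MemL2 (Ω : Set Plane) (u : Plane → ℝ) : Prop := MemLp u 2 (volume.restrict Ω)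

/-- `v ∈ L²(Ω; ℝ²)`. -/
def MemL2Vec (Ω : Set Plane) (v : Plane → Fin 2 → ℝ) : Prop := ∀ i, MemL2 Ω fun x => v x i

/-- `u ∈ H¹(Ω)`: `u` and its weak first partial derivatives are in `L²(Ω)`. -/
def MemH1 (Ω : Set Plane) (u : Plane → ℝ) : Prop :=
  MemL2 Ω u ∧ ∀ j, ∃ g, MemL2 Ω g ∧
    ∀ φ, IsTest Ω φ → ∫ x in Ω, u x * pderiv j φ x = - ∫ x in Ω, g x * φ x

/-- `g` is the weak (row-wise) divergence of the matrix field `τ` in `Ω`. -/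
def IsWeakDiv (Ω : Set Plane) (τ : Plane → Matrix (Fin 2) (Fin 2) ℝ) (g : Plane → Fin 2 → ℝ) :
    Prop :=
  ∀ φ, IsTest Ω φ → ∀ i,
    ∫ x in Ω, ∑ j, τ x i j * pderiv j φ x = - ∫ x in Ω, g x i * φ x

/-- `τ ∈ H(div, Ω; 𝕊)`: symmetric square-integrable matrix fields with square-integrable weak
divergence. -/
def MemHDiv (Ω : Set Plane) (τ : Plane → Matrix (Fin 2) (Fin 2) ℝ) : Prop :=
  (∀ᵐ x ∂(volume.restrict Ω), (τ x).IsSymm) ∧ (∀ i j, MemL2 Ω fun x => τ x i j) ∧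
    ∃ g, MemL2Vec Ω g ∧ IsWeakDiv Ω τ g

open Classical in
/-- The weak divergence of `τ ∈ H(div, Ω; 𝕊)`, unique up to equality almost everywhere in `Ω`. -/
def weakDiv (Ω : Set Plane) (τ : Plane → Matrix (Fin 2) (Fin 2) ℝ) : Plane → Fin 2 → ℝ :=
  if h : ∃ g, MemL2Vec Ω g ∧ IsWeakDiv Ω τ g then h.choose else 0

/-- The `L²` inner product of vector fields. -/
def innerVec (Ω : Set Plane) (v w : Plane → Fin 2 → ℝ) : ℝ := ∫ x in Ω, ∑ i, v x i * w x i

/-- The Frobenius product `A : B`. -/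
def ddot (A B : Matrix (Fin 2) (Fin 2) ℝ) : ℝ := ∑ i, ∑ j, A i j * B i j

/-- The `L²` norm of a matrix field. -/
def normMat (Ω : Set Plane) (τ : Plane → Matrix (Fin 2) (Fin 2) ℝ) : ℝ :=
  Real.sqrt (∫ x in Ω, ddot (τ x) (τ x))

/-! ### Piecewise polynomial fields -/

variable {Ω : Set Plane}

/-- Piecewise polynomial matrix fields: one matrix of polynomials for each cell. A square-integrable
field that is polynomial on each cell is the same as such a family; the family also supplies the
one-sided values on the boundary of each cell. -/
abbrev MatField (T : Triangulation Ω) := T.cells → Matrix (Fin 2) (Fin 2) Poly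

/-- Piecewise polynomial vector fields. -/
abbrev VecField (T : Triangulation Ω) := T.cells → Fin 2 → Poly

/-- The matrix field on the plane given by a piecewise polynomial (defined almost everywhere; it is
set to zero on the boundaries of the cells). -/
def matFun (T : Triangulation Ω) (τ : MatField T) (x : Plane) : Matrix (Fin 2) (Fin 2) ℝ :=
  ∑ K : T.cells, (interior K.1.body).indicator (fun x => mval (τ K) x) x

/-- The vector field on the plane given by a piecewise polynomial. -/
def vecFun (T : Triangulation Ω) (v : VecField T) (x : Plane) : Fin 2 → ℝ :=
  ∑ K : T.cells, (interior K.1.body).indicator (fun x i => pval (v K i) x) x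

/-- `P_m(K; 𝕊)`. -/
def PolyS (m : ℕ) : Set (Matrix (Fin 2) (Fin 2) Poly) :=
  {τ | τ.IsSymm ∧ ∀ i j, (τ i j).totalDegree ≤ m}

/-- The `H(div)` bubbles `B_{k,K}`: polynomials in `P_k(K; 𝕊)` with `τ ν = 0` on each edge, where
`ν` is normal to the edge. -/
def BubbleS (k : ℕ) (K : Triangle) : Set (Matrix (Fin 2) (Fin 2) Poly) :=
  {τ | τ ∈ PolyS k ∧ ∀ i j : Fin 3, i ≠ j → ∀ x ∈ segment ℝ (K.points i) (K.points j),
    ∀ ν : Plane, inner ℝ ν (K.points j - K.points i) = 0 → mval τ x *ᵥ (fun l => ν l) = 0}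

/-- The `H¹`-conforming part of the Hu-Zhang stress space. -/
def SigmaTilde (k : ℕ) (T : Triangulation Ω) : Set (MatField T) :=
  {τ | (∀ i j, MemH1 Ω fun x => matFun T τ x i j) ∧ ∀ K, τ K ∈ PolyS k}

/-- The global `H(div)` bubble space `B_{k,h}`. -/
def BubbleSpace (k : ℕ) (T : Triangulation Ω) : Set (MatField T) :=
  {τ | MemHDiv Ω (matFun T τ) ∧ ∀ K : T.cells, τ K ∈ BubbleS k K.1}

/-- The Hu-Zhang stress space `Σ_{k,h}`. -/
def SigmaHZ (k : ℕ) (T : Triangulation Ω) : Set (MatField T) :=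
  {τ | ∃ a ∈ SigmaTilde k T, ∃ b ∈ BubbleSpace k T, τ = a + b}

/-- The enrichment `Λ_{k,k'}`: on each cell, elements of `∑ b P_i^hom(K; 𝕊)`, `k-2 ≤ i ≤ k'-3`. -/
def Enrich (k k' : ℕ) (T : Triangulation Ω) : Set (MatField T) :=
  {τ | MemHDiv Ω (matFun T τ) ∧ ∀ K : T.cells, ∃ q : ℕ → Matrix (Fin 2) (Fin 2) Poly,
    (∀ n, (q n).IsSymm ∧ ∀ i j, (q n i j).IsHomogeneous n) ∧
    τ K = K.1.bubble • ∑ n ∈ Finset.Icc (k - 2) (k' - 3), q n}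

/-- The stress space `Σ_{k,k',h} = Σ_{k,h} ⊕ Λ_{k,k'}`. -/
def StressSpace (k k' : ℕ) (T : Triangulation Ω) : Set (MatField T) :=
  {τ | ∃ a ∈ SigmaHZ k T, ∃ b ∈ Enrich k k' T, τ = a + b}

/-- The Hu-Zhang displacement space `V_{k,h}` (piecewise `P_{k-1}`). -/
def VHZ (k : ℕ) (T : Triangulation Ω) : Set (VecField T) :=
  {v | ∀ K i, (v K i).totalDegree ≤ k - 1}

/-- The displacement space `V_{k,k',h} = V_{k,h} + div Λ_{k,k'}`. -/
def DispSpace (k k' : ℕ) (T : Triangulation Ω) : Set (VecField T) :=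
  {v | ∃ w ∈ VHZ k T, ∃ τ ∈ Enrich k k' T,
    vecFun T v =ᵐ[volume.restrict Ω] vecFun T w + weakDiv Ω (matFun T τ)}

/-! ### The mass-lumped scheme -/

/-- The compliance tensor `𝒜σ = (σ - λ/(2μ+2λ) tr(σ) I) / (2μ)`. -/
def compliance (lam mu : ℝ) (σ : Matrix (Fin 2) (Fin 2) ℝ) : Matrix (Fin 2) (Fin 2) ℝ :=
  (1 / (2 * mu)) • (σ - (lam / (2 * mu + 2 * lam) * σ.trace) • (1 : Matrix (Fin 2) (Fin 2) ℝ))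

/-- The lumped form `(𝒜σ, τ)_h = ∑_K I_{k,k',K}(𝒜σ : τ)`. -/
def lumped {k k' : ℕ} (Q : LumpingRule k k') (lam mu : ℝ) (T : Triangulation Ω)
    (σ τ : MatField T) : ℝ :=
  ∑ K : T.cells, Q.quad K.1 fun x => ddot (compliance lam mu (mval (σ K) x)) (mval (τ K) x)

/-- `(σ, u)` solves the mass-lumped mixed scheme with body force `f`. -/
structure IsLumpedSolution {k k' : ℕ} (Q : LumpingRule k k') (lam mu : ℝ) (T : Triangulation Ω)
    (f : Plane → Fin 2 → ℝ) (σ : MatField T) (u : VecField T) : Prop where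
  stress_mem : σ ∈ StressSpace k k' T
  displacement_mem : u ∈ DispSpace k k' T
  constitutive : ∀ τ ∈ StressSpace k k' T,
    lumped Q lam mu T σ τ + innerVec Ω (weakDiv Ω (matFun T τ)) (vecFun T u) = 0
  equilibrium : ∀ v ∈ DispSpace k k' T,
    - innerVec Ω (weakDiv Ω (matFun T σ)) (vecFun T v) = innerVec Ω f (vecFun T v)

end LumpedElasticity

end

/-!
Coercivity: on the reference triangle, a function of `P_{k,k'}` is the combination of the nodal
basis with its nodal values as coefficients. As the weights are positive, Cauchy–Schwarz bounds its
`L²` norm by the quadrature of its square, and this is invariant under affine maps since both sides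
scale with the area.

Solvability: the scheme is a square linear system, so it suffices that its kernel is trivial.
Coercivity gives `σ = 0`, and then `u` is orthogonal to `div τ` for every discrete stress `τ`.
Testing with the bubbles and the enrichment shows that `u` is a rigid motion on each cell. Let `n`
be normal to an edge `[p, q]` and let `d` be the jump of `u` across it (or `u` itself on the
boundary). The field `λ_p λ_q (d nᵀ + n dᵀ)` on the one or two cells at the edge is
`H¹`-conforming, and testing with it gives `d = 0` on the edge. So a cell on which `u ≠ 0` has no
edge on the boundary of the union of all such cells. But a nonempty bounded union of cells has
frontier points other than vertices, because finitely many points do not separate the plane.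
-/

noncomputable section

namespace LumpedElasticity

variable {Ω : Set Plane}

/-! ### Polynomials as functions -/

@[simp] lemma pval_add (p q : Poly) (x : Plane) : pval (p + q) x = pval p x + pval q x := map_add ..

@[simp] lemma pval_sub (p q : Poly) (x : Plane) : pval (p - q) x = pval p x - pval q x := map_sub ..

@[simp] lemma pval_mul (p q : Poly) (x : Plane) : pval (p * q) x = pval p x * pval q x := map_mul ..

@[simp] lemma pval_pow (p : Poly) (n : ℕ) (x : Plane) : pval (p ^ n) x = pval p x ^ n := map_pow ..

@[simp] lemma pval_zero (x : Plane) : pval 0 x = 0 := map_zero _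

@[simp] lemma pval_C (c : ℝ) (x : Plane) : pval (MvPolynomial.C c) x = c := MvPolynomial.eval_C c

@[simp] lemma pval_X (i : Fin 2) (x : Plane) : pval (MvPolynomial.X i) x = x i :=
  MvPolynomial.eval_X i

@[simp] lemma pval_smul (c : ℝ) (p : Poly) (x : Plane) : pval (c • p) x = c * pval p x :=
  MvPolynomial.smul_eval ..

@[simp] lemma pval_sum {ι : Type*} (s : Finset ι) (p : ι → Poly) (x : Plane) :
    pval (∑ i ∈ s, p i) x = ∑ i ∈ s, pval (p i) x :=
  map_sum ..

@[fun_prop] lemma contDiff_pval (p : Poly) {n : WithTop ℕ∞} : ContDiff ℝ n (pval p) :=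
  (AnalyticOnNhd.eval_mvPolynomial p).contDiff.comp PiLp.contDiff_ofLp

@[fun_prop] lemma continuous_pval (p : Poly) : Continuous (pval p) :=
  (contDiff_pval p (n := 0)).continuous

@[fun_prop] lemma differentiable_pval (p : Poly) : Differentiable ℝ (pval p) :=
  (contDiff_pval p (n := 1)).differentiable one_ne_zero

lemma pderiv_pval (j : Fin 2) (p : Poly) (x : Plane) :
    pderiv j (pval p) x = pval (MvPolynomial.pderiv j p) x := by
  unfold pderiv
  induction p using MvPolynomial.induction_on with
  | C a => simp [funext (pval_C a)]
  | add p q hp hq =>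
    rw [show pval (p + q) = pval p + pval q from funext (pval_add p q),
      fderiv_add (by fun_prop) (by fun_prop)]
    simp [hp, hq]
  | mul_X p i hp =>
    have h_coord : fderiv ℝ (fun x : Plane => x i) x = EuclideanSpace.proj i :=
      ContinuousLinearMap.fderiv (EuclideanSpace.proj i : Plane →L[ℝ] ℝ)
    rw [show pval (p * MvPolynomial.X i) = pval p * fun x => x i by ext; simp,
      fderiv_mul (by fun_prop) (by fun_prop), h_coord]
    by_cases hij : i = j <;> simp [hp, MvPolynomial.pderiv_X, hij]

lemma eq_zero_of_pval_eq_zero {U : Set Plane} (hU : IsOpen U) (hne : U.Nonempty) {p : Poly}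
    (h : ∀ x ∈ U, pval p x = 0) : p = 0 := by
  obtain ⟨x, hx⟩ := hne
  obtain ⟨ε, hε, hball⟩ := Metric.isOpen_iff.1
    (hU.preimage (PiLp.continuous_toLp 2 fun _ : Fin 2 => ℝ)) x.ofLp hx
  refine MvPolynomial.funext_set (fun i => Metric.ball (x i) ε)
    (fun i => Real.ball_eq_Ioo (x i) ε ▸ Ioo_infinite (by linarith)) fun y hy => ?_
  rw [map_zero]
  exact h _ (hball (by rwa [ball_pi _ hε]))

lemma totalDegree_pderiv_le {σ R : Type*} [CommSemiring R] (p : MvPolynomial σ R) (i : σ) :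
    (MvPolynomial.pderiv i p).totalDegree ≤ p.totalDegree - 1 := by
  refine Finset.sup_le fun m hm => ?_
  rw [MvPolynomial.mem_support_iff, MvPolynomial.coeff_pderiv] at hm
  have hdeg := MvPolynomial.le_totalDegree
    (MvPolynomial.mem_support_iff.2 (left_ne_zero_of_mul hm))
  rw [Finsupp.sum_add_index' (fun _ => rfl) (fun _ _ _ => rfl),
    Finsupp.sum_single_index rfl] at hdeg
  omega

/-! ### Barycentric coordinates -/

namespace Triangle

variable (K : Triangle)

/-- Twice the signed area of `K`. -/
def det : ℝ :=
  (K.points 1 0 - K.points 0 0) * (K.points 2 1 - K.points 0 1)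
    - (K.points 1 1 - K.points 0 1) * (K.points 2 0 - K.points 0 0)

lemma det_ne_zero : K.det ≠ 0 := by
  have hind := (affineIndependent_iff_linearIndependent_vsub ℝ _ (0 : Fin 3)).1 K.independent
  have hvec := hind.comp (fun i : Fin 2 => ⟨i.succ, i.succ_ne_zero⟩) fun i l h => by simpa using h
  have hrows := hvec.map' (WithLp.linearEquiv 2 ℝ (Fin 2 → ℝ)).toLinearMap (LinearEquiv.ker _)
  have hunit : IsUnit (Matrix.of fun i l : Fin 2 => K.points i.succ l - K.points 0 l) :=
    Matrix.linearIndependent_rows_iff_isUnit.1 hrows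
  have hdet := ((Matrix.isUnit_iff_isUnit_det _).1 hunit).ne_zero
  rwa [Matrix.det_fin_two] at hdet

lemma abs_det_pos : 0 < |K.det| := abs_pos.2 K.det_ne_zero

/-- The gradient of the barycentric coordinate `K.bary j`; it is normal to the edge opposite to
the vertex `j`. -/
def baryGrad (j : Fin 3) : Fin 2 → ℝ :=
  K.det⁻¹ • ![K.points (j + 1) 1 - K.points (j + 2) 1, K.points (j + 2) 0 - K.points (j + 1) 0]

lemma bary_eq (j : Fin 3) : K.bary j = MvPolynomial.C (K.baryGrad j 0) * MvPolynomial.X 0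
    + MvPolynomial.C (K.baryGrad j 1) * MvPolynomial.X 1
    + MvPolynomial.C (-(K.baryGrad j 0 * K.points (j + 1) 0
      + K.baryGrad j 1 * K.points (j + 1) 1)) := by
  have hdet : (K.points (j + 1) 0 - K.points j 0) * (K.points (j + 2) 1 - K.points j 1)
      - (K.points (j + 1) 1 - K.points j 1) * (K.points (j + 2) 0 - K.points j 0) = K.det := by
    unfold det
    fin_cases j <;> simp <;> ring
  simp only [bary, hdet, baryGrad, Pi.smul_apply, Matrix.cons_val_zero, Matrix.cons_val_one,
    smul_eq_mul, map_mul, map_sub, map_neg, map_add]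
  ring

lemma pval_bary (j : Fin 3) (x : Plane) :
    pval (K.bary j) x = ∑ i, K.baryGrad j i * (x i - K.points (j + 1) i) := by
  rw [K.bary_eq, Fin.sum_univ_two]
  simp only [pval_add, pval_mul, pval_C, pval_X]
  ring

lemma totalDegree_bary (j : Fin 3) : (K.bary j).totalDegree ≤ 1 := by
  have hlin (c : ℝ) (i : Fin 2) : (MvPolynomial.C c * MvPolynomial.X i : Poly).totalDegree ≤ 1 :=
    (MvPolynomial.totalDegree_mul _ _).trans (by simp)
  rw [K.bary_eq]
  exact (MvPolynomial.totalDegree_add _ _).trans (max_le ((MvPolynomial.totalDegree_add _ _).trans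
    (max_le (hlin _ _) (hlin _ _))) ((MvPolynomial.totalDegree_C _).le.trans zero_le_one))

lemma bary_pointOf {α : Fin 3 → ℝ} (h : ∑ j, α j = 1) (j : Fin 3) :
    pval (K.bary j) (K.pointOf α) = α j := by
  have hd := K.det_ne_zero
  have h₀ : α 0 = 1 - α 1 - α 2 := by rw [← h, Fin.sum_univ_three]; ring
  simp only [K.pval_bary, baryGrad, Fin.sum_univ_two, Pi.smul_apply, smul_eq_mul]
  field_simp
  fin_cases j <;> simp [pointOf, Fin.sum_univ_three, det, h₀] <;> ring

/-- The vertices of `K` as an affine basis of the plane. -/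
def affineBasis : AffineBasis (Fin 3) ℝ Plane :=
  ⟨K.points, K.independent, K.independent.affineSpan_eq_top_iff_card_eq_finrank_add_one.2
    (by simp)⟩

lemma pointOf_coord (x : Plane) : K.pointOf (fun j => K.affineBasis.coord j x) = x :=
  K.affineBasis.linear_combination_coord_eq_self x

lemma pval_bary_eq_coord (j : Fin 3) (x : Plane) :
    pval (K.bary j) x = K.affineBasis.coord j x := by
  conv_lhs => rw [← K.pointOf_coord x]
  exact K.bary_pointOf (K.affineBasis.sum_coord_apply_eq_one x) j

lemma pointOf_bary (x : Plane) : K.pointOf (fun j => pval (K.bary j) x) = x := by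
  simp only [pval_bary_eq_coord, pointOf_coord]

lemma sum_bary (x : Plane) : ∑ j, pval (K.bary j) x = 1 := by
  simp only [pval_bary_eq_coord, K.affineBasis.sum_coord_apply_eq_one]

lemma bary_points (j i : Fin 3) : pval (K.bary j) (K.points i) = if j = i then 1 else 0 := by
  rw [pval_bary_eq_coord]
  exact K.affineBasis.coord_apply j i

lemma bary_lineMap (j : Fin 3) (x y : Plane) (t : ℝ) :
    pval (K.bary j) (AffineMap.lineMap x y t) =
      AffineMap.lineMap (pval (K.bary j) x) (pval (K.bary j) y) t := by
  simp only [pval_bary_eq_coord, AffineMap.apply_lineMap]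

lemma body_eq : K.body = {x | ∀ j, 0 ≤ pval (K.bary j) x} := by
  simp only [pval_bary_eq_coord]
  exact K.affineBasis.convexHull_eq_nonneg_coord

lemma interior_body : interior K.body = {x | ∀ j, 0 < pval (K.bary j) x} := by
  simp only [pval_bary_eq_coord]
  exact K.affineBasis.interior_convexHull

lemma isCompact_body : IsCompact K.body := (finite_range _).isCompact_convexHull (𝕜 := ℝ)

lemma measurableSet_body : MeasurableSet K.body := K.isCompact_body.isClosed.measurableSet

lemma interior_nonempty : (interior K.body).Nonempty :=
  ⟨_, K.affineBasis.centroid_mem_interior_convexHull⟩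

lemma interior_ae_eq : interior K.body =ᵐ[volume] K.body :=
  interior_ae_eq_of_null_frontier ((convex_convexHull ℝ _).addHaar_frontier volume)

lemma integrableOn_body {g : Plane → ℝ} (hg : Continuous g) : IntegrableOn g K.body :=
  hg.continuousOn.integrableOn_compact K.isCompact_body

end Triangle

/-! ### Integrals over triangles -/

@[simp] lemma det_refTriangle : refTriangle.det = 1 := by
  simp [Triangle.det, refTriangle]

lemma pval_bary_refTriangle (x : Plane) (j : Fin 3) :
    pval (refTriangle.bary j) x = ![1 - x 0 - x 1, x 0, x 1] j := by
  simp only [refTriangle.pval_bary, Triangle.baryGrad, det_refTriangle, inv_one, one_smul,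
    Fin.sum_univ_two]
  fin_cases j <;> simp [refTriangle]
  ring

lemma mem_body_refTriangle {x : Plane} :
    x ∈ refTriangle.body ↔ 0 ≤ x 0 ∧ 0 ≤ x 1 ∧ x 0 + x 1 ≤ 1 := by
  simp only [refTriangle.body_eq, mem_ofPred_eq, pval_bary_refTriangle, Fin.forall_fin_succ]
  constructor
  · rintro ⟨h₀, h₁, h₂, -⟩
    exact ⟨h₁, h₂, by simp at h₀; linarith⟩
  · rintro ⟨h₁, h₂, h₀⟩
    exact ⟨by simp; linarith, h₁, h₂, fun i => i.elim0⟩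

namespace Triangle

variable (K : Triangle)

/-- The affine map from the reference triangle onto `K` that preserves barycentric coordinates. -/
def fromRef (x : Plane) : Plane := K.pointOf fun j => pval (refTriangle.bary j) x

lemma pval_bary_fromRef (j : Fin 3) (x : Plane) :
    pval (K.bary j) (K.fromRef x) = pval (refTriangle.bary j) x :=
  K.bary_pointOf (refTriangle.sum_bary x) j

lemma fromRef_pointOf {α : Fin 3 → ℝ} (h : ∑ j, α j = 1) :
    K.fromRef (refTriangle.pointOf α) = K.pointOf α := by
  simp only [fromRef, refTriangle.bary_pointOf h]

lemma fromRef_injective : Function.Injective K.fromRef := fun x y h => by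
  rw [← refTriangle.pointOf_bary x, ← refTriangle.pointOf_bary y]
  simp only [← K.pval_bary_fromRef, h]

lemma image_fromRef : K.fromRef '' refTriangle.body = K.body := by
  ext y
  rw [K.body_eq, refTriangle.body_eq]
  constructor
  · rintro ⟨x, hx, rfl⟩ j
    rw [K.pval_bary_fromRef]
    exact hx j
  · refine fun hy => ⟨refTriangle.pointOf fun j => pval (K.bary j) y, fun j => ?_, ?_⟩
    · rw [refTriangle.bary_pointOf (K.sum_bary y)]
      exact hy j
    · rw [K.fromRef_pointOf (K.sum_bary y), K.pointOf_bary]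

/-- The derivative of the affine map `K.fromRef`. -/
def fromRefLinear : Plane →L[ℝ] Plane :=
  (EuclideanSpace.proj 0).smulRight (K.points 1 - K.points 0)
    + (EuclideanSpace.proj 1).smulRight (K.points 2 - K.points 0)

lemma det_fromRefLinear : K.fromRefLinear.det = K.det := by
  rw [ContinuousLinearMap.det,
    ← LinearMap.det_toMatrix (EuclideanSpace.basisFun (Fin 2) ℝ).toBasis, Matrix.det_fin_two]
  simp [LinearMap.toMatrix_apply, fromRefLinear, det]
  ring

lemma fromRef_eq (x : Plane) : K.fromRef x = K.points 0 + K.fromRefLinear x := by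
  ext i
  simp [fromRef, pointOf, Fin.sum_univ_three, fromRefLinear, pval_bary_refTriangle]
  ring

lemma hasFDerivAt_fromRef (x : Plane) : HasFDerivAt K.fromRef K.fromRefLinear x := by
  rw [funext K.fromRef_eq]
  exact K.fromRefLinear.hasFDerivAt.const_add _

@[fun_prop] lemma continuous_fromRef : Continuous K.fromRef := by
  rw [funext K.fromRef_eq]
  fun_prop

lemma integral_body (g : Plane → ℝ) :
    ∫ x in K.body, g x = |K.det| * ∫ x in refTriangle.body, g (K.fromRef x) := by
  rw [← K.image_fromRef, integral_image_eq_integral_abs_det_fderiv_smul volume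
    refTriangle.measurableSet_body (fun x _ => (K.hasFDerivAt_fromRef x).hasFDerivWithinAt)
    K.fromRef_injective.injOn, K.det_fromRefLinear]
  simp only [smul_eq_mul, integral_const_mul]

end Triangle

lemma integral_refTriangle_eq_prod (g : Plane → ℝ) :
    ∫ x in refTriangle.body, g x =
      ∫ z in {z : ℝ × ℝ | 0 ≤ z.1 ∧ 0 ≤ z.2 ∧ z.1 + z.2 ≤ 1}, g !₂[z.1, z.2] := by
  rw [← ((PiLp.volume_preserving_toLp (Fin 2)).comp
      (volume_preserving_finTwoArrow ℝ).symm).setIntegral_preimage_emb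
    ((MeasurableEquiv.toLp 2 (Fin 2 → ℝ)).measurableEmbedding.comp
      MeasurableEquiv.finTwoArrow.symm.measurableEmbedding)]
  congr 2
  ext z
  exact mem_body_refTriangle

lemma isCompact_unitTriangle : IsCompact {z : ℝ × ℝ | 0 ≤ z.1 ∧ 0 ≤ z.2 ∧ z.1 + z.2 ≤ 1} := by
  refine (isCompact_Icc (a := ((0, 0) : ℝ × ℝ)) (b := (1, 1))).of_isClosed_subset ?_ ?_
  · exact (isClosed_le continuous_const continuous_fst).inter
      ((isClosed_le continuous_const continuous_snd).inter
        (isClosed_le (continuous_fst.add continuous_snd) continuous_const))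
  · rintro ⟨s, t⟩ ⟨hs, ht, hst⟩
    dsimp only at hs ht hst
    exact ⟨⟨hs, ht⟩, by dsimp only; linarith, by dsimp only; linarith⟩

lemma setIntegral_eq_iterated_of_fiber_eq_Icc {S : Set (ℝ × ℝ)} (hS : IsCompact S)
    {a b : ℝ} (hab : a ≤ b) {lo hi : ℝ → ℝ} (hle : ∀ s ∈ Icc a b, lo s ≤ hi s)
    (hmem : ∀ s t, (s, t) ∈ S ↔ s ∈ Icc a b ∧ t ∈ Icc (lo s) (hi s))
    {g : ℝ × ℝ → ℝ} (hg : ContinuousOn g S) :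
    ∫ z in S, g z = ∫ s in a..b, ∫ t in lo s..hi s, g (s, t) := by
  rw [← integral_indicator hS.measurableSet, Measure.volume_eq_prod,
    integral_prod _ ((hg.integrableOn_compact hS).integrable_indicator hS.measurableSet),
    intervalIntegral.integral_of_le hab, ← integral_Icc_eq_integral_Ioc,
    ← integral_indicator measurableSet_Icc]
  refine integral_congr_ae (.of_forall fun s => ?_)
  by_cases hs : s ∈ Icc a b
  · simp only [intervalIntegral.integral_of_le (hle s hs), ← integral_Icc_eq_integral_Ioc,
      ← integral_indicator measurableSet_Icc, indicator, hmem, hs, true_and, if_true]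
  · simp only [indicator, hmem, hs, false_and, if_false, integral_zero]

lemma integral_refTriangle {g : Plane → ℝ} (hg : Continuous g) :
    ∫ x in refTriangle.body, g x = ∫ s in (0 : ℝ)..1, ∫ t in (0 : ℝ)..(1 - s), g !₂[s, t] := by
  rw [integral_refTriangle_eq_prod]
  refine setIntegral_eq_iterated_of_fiber_eq_Icc isCompact_unitTriangle zero_le_one
    (g := fun z => g !₂[z.1, z.2]) (fun s hs => sub_nonneg.2 hs.2) (fun s t => ?_) (by fun_prop)
  simp only [mem_ofPred_eq, mem_Icc]
  exact ⟨fun ⟨_, _, _⟩ => ⟨⟨by assumption, by linarith⟩, by assumption, by linarith⟩,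
    fun ⟨⟨_, _⟩, _, _⟩ => ⟨by assumption, by assumption, by linarith⟩⟩

/-! ### Green's formula on a triangle -/

/-- The mean value of `F` on the segment from `a` to `b`. -/
def segmentMean (a b : Plane) (F : Plane → ℝ) : ℝ :=
  ∫ t in (0 : ℝ)..1, F (AffineMap.lineMap a b t)

lemma segmentMean_comm (a b : Plane) (F : Plane → ℝ) : segmentMean a b F = segmentMean b a F := by
  have h := intervalIntegral.integral_comp_sub_left (a := 0) (b := 1)
    (fun t => F (AffineMap.lineMap b a t)) 1
  simpa only [AffineMap.lineMap_apply_one_sub, sub_self, sub_zero, segmentMean] using h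

namespace Triangle

variable (K : Triangle)

/-- The mean value of `F` on the edge opposite to the vertex `j`. -/
def edgeMean (j : Fin 3) (F : Plane → ℝ) : ℝ :=
  segmentMean (K.points (j + 1)) (K.points (j + 2)) F

/-- The normal of the edge opposite to the vertex `j` that points into `K`, with the length of
that edge. -/
def inwardNormal (j : Fin 3) (i : Fin 2) : ℝ := |K.det| * K.baryGrad j i

lemma inwardNormal_ne_zero (j : Fin 3) : K.inwardNormal j ≠ 0 := fun h => by
  have hgrad : K.baryGrad j = 0 := funext fun i =>
    (mul_eq_zero.1 (congrFun h i)).resolve_left K.abs_det_pos.ne'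
  have hself := K.bary_points j j
  simp [K.pval_bary, hgrad] at hself

lemma sum_baryGrad (i : Fin 2) : ∑ j, K.baryGrad j i = 0 := by
  fin_cases i <;> simp [baryGrad, Fin.sum_univ_three] <;> ring

lemma single_eq_baryGrad_smul (i : Fin 2) : (EuclideanSpace.single i 1 : Plane) =
    K.baryGrad 1 i • (K.points 1 - K.points 0) + K.baryGrad 2 i • (K.points 2 - K.points 0) := by
  have hd := K.det_ne_zero
  ext l
  rw [← mul_right_inj' hd]
  fin_cases i <;> fin_cases l <;> simp [baryGrad] <;> field_simp <;> simp [det] <;> ring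

/-- Green's formula for the derivative along a side: integrate along the lines parallel to it. -/
lemma integral_fderiv_side {F : Plane → ℝ} (hF : ContDiff ℝ 1 F) :
    ∫ x in K.body, fderiv ℝ F x (K.points 2 - K.points 0) =
      |K.det| * (K.edgeMean 0 F - K.edgeMean 2 F) := by
  set e := K.points 2 - K.points 0
  have hcont : Continuous fun x => fderiv ℝ F (K.fromRef x) e :=
    ((hF.continuous_fderiv one_ne_zero).comp K.continuous_fromRef).clm_apply continuous_const
  have hderiv (s t : ℝ) : HasDerivAt (fun t => F (K.fromRef !₂[s, t]))
      (fderiv ℝ F (K.fromRef !₂[s, t]) e) t := by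
    have hline : HasDerivAt (fun t : ℝ => K.fromRef !₂[s, t]) e t := by
      have haff : (fun t : ℝ => K.fromRef !₂[s, t]) = fun t : ℝ => K.fromRef !₂[s, 0] + t • e := by
        ext t : 1
        simp [K.fromRef_eq, fromRefLinear, e, add_assoc]
      rw [haff]
      simpa using ((hasDerivAt_id t).smul_const e).const_add (K.fromRef !₂[s, 0])
    exact (hF.differentiable one_ne_zero _).hasFDerivAt.comp_hasDerivAt t hline
  have hend (s : ℝ) : K.fromRef !₂[s, 1 - s] = AffineMap.lineMap (K.points 2) (K.points 1) s := by
    simp only [K.fromRef_eq, fromRefLinear, AffineMap.lineMap_apply]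
    ext i
    simp
    ring
  have hstart (s : ℝ) : K.fromRef !₂[s, 0] = AffineMap.lineMap (K.points 0) (K.points 1) s := by
    simp [K.fromRef_eq, fromRefLinear, AffineMap.lineMap_apply, add_comm]
  have hFc := hF.continuous
  rw [K.integral_body, integral_refTriangle hcont]
  congr 1
  calc ∫ s in (0 : ℝ)..1, ∫ t in (0 : ℝ)..(1 - s), fderiv ℝ F (K.fromRef !₂[s, t]) e
      = ∫ s in (0 : ℝ)..1, (F (AffineMap.lineMap (K.points 2) (K.points 1) s)
          - F (AffineMap.lineMap (K.points 0) (K.points 1) s)) := by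
        congr 1
        ext s
        rw [intervalIntegral.integral_eq_sub_of_hasDerivAt (fun t _ => hderiv s t)
          (Continuous.intervalIntegrable (by fun_prop) _ _), hend, hstart]
    _ = segmentMean (K.points 2) (K.points 1) F - K.edgeMean 2 F := by
        exact intervalIntegral.integral_sub
          ((hFc.comp AffineMap.lineMap_continuous).intervalIntegrable _ _)
          ((hFc.comp AffineMap.lineMap_continuous).intervalIntegrable _ _)
    _ = K.edgeMean 0 F - K.edgeMean 2 F := by rw [segmentMean_comm]; rfl

lemma integral_fderiv_side' {F : Plane → ℝ} (hF : ContDiff ℝ 1 F) :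
    ∫ x in K.body, fderiv ℝ F x (K.points 1 - K.points 0) =
      |K.det| * (K.edgeMean 0 F - K.edgeMean 1 F) := by
  let L : Triangle := K.reindex (Equiv.swap 1 2)
  have hp : L.points = ![K.points 0, K.points 2, K.points 1] := by
    ext j : 1
    fin_cases j <;> rfl
  have hbody : L.body = K.body := by simp only [body, L, Affine.Simplex.reindex_range_points]
  have hdet : |L.det| = |K.det| := by
    rw [← abs_neg]
    congr 1
    simp [det, hp]
    ring
  have hedge₀ : L.edgeMean 0 F = K.edgeMean 0 F := by
    simp only [edgeMean, hp]
    exact segmentMean_comm _ _ _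
  have hedge₂ : L.edgeMean 2 F = K.edgeMean 1 F := by
    simp only [edgeMean, hp]
    exact segmentMean_comm _ _ _
  have hside : L.points 2 - L.points 0 = K.points 1 - K.points 0 := by rw [hp]; rfl
  rw [← hside, ← hbody, L.integral_fderiv_side hF, hdet, hedge₀, hedge₂]

theorem green {F : Plane → ℝ} (hF : ContDiff ℝ 1 F) (i : Fin 2) :
    ∫ x in K.body, pderiv i F x = -∑ j, K.inwardNormal j i * K.edgeMean j F := by
  have hintegrable (v : Plane) : IntegrableOn (fun x => fderiv ℝ F x v) K.body :=
    K.integrableOn_body ((hF.continuous_fderiv one_ne_zero).clm_apply continuous_const)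
  have hgrad : K.baryGrad 0 i = -K.baryGrad 1 i - K.baryGrad 2 i := by
    have h := K.sum_baryGrad i
    rw [Fin.sum_univ_three] at h
    linarith
  simp only [pderiv, K.single_eq_baryGrad_smul i, map_add, map_smul, smul_eq_mul]
  rw [integral_add ((hintegrable _).const_mul _) ((hintegrable _).const_mul _), integral_const_mul,
    integral_const_mul, K.integral_fderiv_side hF, K.integral_fderiv_side' hF]
  simp only [Fin.sum_univ_three, inwardNormal, hgrad]
  ring

end Triangle

/-! ### Triangulations -/

namespace Triangle

variable (K : Triangle)

lemma bary_ne_zero (j : Fin 3) : K.bary j ≠ 0 := fun h => by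
  simpa [h] using K.bary_points j j

lemma bary_eq_zero_of_mem_segment {i i' j : Fin 3} (hi : i ≠ j) (hi' : i' ≠ j) {x : Plane}
    (hx : x ∈ segment ℝ (K.points i) (K.points i')) : pval (K.bary j) x = 0 := by
  rw [segment_eq_image_lineMap] at hx
  obtain ⟨t, -, rfl⟩ := hx
  simp [K.bary_lineMap, K.bary_points, hi.symm, hi'.symm]

lemma segment_subset_body (i i' : Fin 3) : segment ℝ (K.points i) (K.points i') ⊆ K.body :=
  segment_subset_convexHull (mem_range_self i) (mem_range_self i')

lemma body_subset_closure_interior : K.body ⊆ closure (interior K.body) := by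
  have h := Convex.closure_interior_eq_closure_of_nonempty_interior
    (convex_convexHull ℝ (range K.points)) K.interior_nonempty
  exact subset_closure.trans h.ge

end Triangle

namespace Triangulation

variable (T : Triangulation Ω)

lemma disjoint_interior :
    Pairwise (Function.onFun Disjoint fun K : T.cells => interior K.1.body) := by
  intro K L hKL
  rw [Function.onFun, disjoint_iff_inter_eq_empty]
  by_contra! hne
  have hsub : interior K.1.body ∩ interior L.1.body ⊆ K.1.body ∩ L.1.body :=
    inter_subset_inter interior_subset interior_subset
  have hnot (i i' : Fin 3) :
      ¬K.1.body ∩ L.1.body ⊆ segment ℝ (K.1.points i) (K.1.points i') := fun h => by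
    obtain ⟨j, hj, hj'⟩ : ∃ j : Fin 3, i ≠ j ∧ i' ≠ j := by
      clear h
      revert i i'
      decide
    exact K.1.bary_ne_zero j <| eq_zero_of_pval_eq_zero (isOpen_interior.inter isOpen_interior) hne
      fun x hx => K.1.bary_eq_zero_of_mem_segment hj hj' (h (hsub hx))
  rcases T.conforming K.1 K.2 L.1 L.2 (Subtype.coe_injective.ne hKL) with
    h | ⟨i, j, -, h⟩ | ⟨i, i', j, j', -, -, -, h⟩
  · exact (hne.mono hsub).ne_empty h
  · exact hnot i i (by rw [h, segment_same])
  · exact hnot i i' h.le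

lemma body_subset (K : T.cells) : K.1.body ⊆ closure Ω := by
  rw [← T.cover]
  exact subset_biUnion_of_mem (u := fun K : Triangle => K.body) K.2

lemma exists_mem_body {x : Plane} (hx : x ∈ closure Ω) : ∃ K : T.cells, x ∈ K.1.body := by
  rw [← T.cover] at hx
  obtain ⟨K, hK, hxK⟩ := mem_iUnion₂.1 hx
  exact ⟨⟨K, hK⟩, hxK⟩

lemma interior_subset (hΩ : IsPolygonal Ω) (K : T.cells) : interior K.1.body ⊆ Ω :=
  (interior_mono (T.body_subset K)).trans hΩ.regular.le

/-- The union of the open cells, which is `Ω` up to a null set. -/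
def openCells : Set Plane := ⋃ K : T.cells, interior K.1.body

lemma isOpen_openCells : IsOpen T.openCells := isOpen_iUnion fun _ => isOpen_interior

lemma openCells_subset (hΩ : IsPolygonal Ω) : T.openCells ⊆ Ω :=
  iUnion_subset (T.interior_subset hΩ)

lemma openCells_ae_eq (hΩ : IsPolygonal Ω) : T.openCells =ᵐ[volume] Ω := by
  have hbodies : T.openCells =ᵐ[volume] ⋃ K : T.cells, K.1.body :=
    Filter.EventuallyEq.countable_iUnion fun K => K.1.interior_ae_eq
  have hsub : Ω ⊆ ⋃ K : T.cells, K.1.body := fun x hx =>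
    mem_iUnion.2 (T.exists_mem_body (subset_closure hx))
  exact Filter.EventuallyLE.antisymm (.of_forall (T.openCells_subset hΩ))
    (Filter.EventuallyLE.trans (.of_forall hsub) hbodies.symm.le)

lemma restrict_openCells (hΩ : IsPolygonal Ω) :
    volume.restrict T.openCells = volume.restrict Ω :=
  Measure.restrict_congr_set (T.openCells_ae_eq hΩ)

lemma bary_pos_of_mem_openCells {K : T.cells} {x : Plane} (hx : x ∈ T.openCells)
    (hxK : x ∈ K.1.body) (j : Fin 3) : 0 < pval (K.1.bary j) x := by
  obtain ⟨L, hxL⟩ := mem_iUnion.1 hx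
  obtain rfl : K = L := by
    by_contra hne
    exact disjoint_left.1 ((T.disjoint_interior hne).closure_left isOpen_interior)
      (K.1.body_subset_closure_interior hxK) hxL
  rw [K.1.interior_body] at hxL
  exact hxL j

section Integral

variable (hΩ : IsPolygonal Ω) {G : Plane → ℝ} {g : T.cells → Plane → ℝ}
  (hg : ∀ K, Continuous (g K)) (h : ∀ K, EqOn G (g K) (interior K.1.body))
include hg h

lemma integrableOn_interior (K : T.cells) : IntegrableOn G (interior K.1.body) :=
  ((K.1.integrableOn_body (hg K)).mono_set _root_.interior_subset).congr_fun (h K).symm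
    isOpen_interior.measurableSet

include hΩ

lemma integrableOn : IntegrableOn G Ω := by
  rw [IntegrableOn, ← T.restrict_openCells hΩ]
  exact integrableOn_finite_iUnion.2 (T.integrableOn_interior hg h)

lemma integral_eq_sum : ∫ x in Ω, G x = ∑ K : T.cells, ∫ x in K.1.body, g K x := by
  rw [← T.restrict_openCells hΩ, openCells, integral_iUnion_fintype
    (fun K => isOpen_interior.measurableSet) T.disjoint_interior (T.integrableOn_interior hg h)]
  refine Finset.sum_congr rfl fun K _ => ?_
  rw [setIntegral_congr_fun isOpen_interior.measurableSet (h K),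
    setIntegral_congr_set K.1.interior_ae_eq]

end Integral

end Triangulation

/-! ### Piecewise polynomials as functions -/

/-- The function given by a scalar piecewise polynomial; like `matFun`, it is zero on the boundaries
of the cells. -/
def scalFun (T : Triangulation Ω) (u : T.cells → Poly) (x : Plane) : ℝ :=
  ∑ K : T.cells, (interior K.1.body).indicator (pval (u K)) x

section PiecewisePolynomial

variable (T : Triangulation Ω)

lemma scalFun_eq (u : T.cells → Poly) (K : T.cells) {x : Plane} (hx : x ∈ interior K.1.body) :
    scalFun T u x = pval (u K) x := by
  unfold scalFun
  rw [Finset.sum_eq_single K, indicator_of_mem hx]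
  · exact fun L _ hL => indicator_of_notMem
      (fun hxL => disjoint_left.1 (T.disjoint_interior hL) hxL hx) _
  · simp

lemma matFun_apply (τ : MatField T) (x : Plane) (i j : Fin 2) :
    matFun T τ x i j = scalFun T (fun K => τ K i j) x := by
  simp only [matFun, scalFun, Matrix.sum_apply]
  refine Finset.sum_congr rfl fun K _ => ?_
  by_cases h : x ∈ interior K.1.body <;> simp [h, mval]

lemma vecFun_apply (v : VecField T) (x : Plane) (i : Fin 2) :
    vecFun T v x i = scalFun T (fun K => v K i) x := by
  simp only [vecFun, scalFun, Finset.sum_apply]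
  refine Finset.sum_congr rfl fun K _ => ?_
  by_cases h : x ∈ interior K.1.body <;> simp [h]

lemma scalFun_add (u v : T.cells → Poly) (x : Plane) :
    scalFun T (fun K => u K + v K) x = scalFun T u x + scalFun T v x := by
  simp only [scalFun, ← Finset.sum_add_distrib]
  refine Finset.sum_congr rfl fun K _ => ?_
  by_cases h : x ∈ interior K.1.body <;> simp [h]

lemma scalFun_smul (c : ℝ) (u : T.cells → Poly) (x : Plane) :
    scalFun T (fun K => c • u K) x = c * scalFun T u x := by
  simp only [scalFun, Finset.mul_sum]
  refine Finset.sum_congr rfl fun K _ => ?_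
  by_cases h : x ∈ interior K.1.body <;> simp [h]

lemma memL2_scalFun (U : Set Plane) (u : T.cells → Poly) : MemL2 U (scalFun T u) := by
  refine memLp_finsetSum _ fun K _ => ?_
  refine MemLp.restrict U ?_
  rw [memLp_indicator_iff_restrict isOpen_interior.measurableSet,
    Measure.restrict_congr_set K.1.interior_ae_eq]
  obtain ⟨C, hC⟩ := K.1.isCompact_body.exists_bound_of_continuousOn
    (continuous_pval (u K)).continuousOn
  have : IsFiniteMeasure (volume.restrict K.1.body) :=
    isFiniteMeasure_restrict.2 K.1.isCompact_body.measure_ne_top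
  exact MemLp.of_bound (continuous_pval _).aestronglyMeasurable C
    ((ae_restrict_iff' K.1.measurableSet_body).2 (.of_forall hC))

end PiecewisePolynomial

/-! ### Weak derivatives of piecewise polynomials -/

/-- The cellwise divergence of a piecewise polynomial matrix field. -/
def pdiv (T : Triangulation Ω) (τ : MatField T) : VecField T :=
  fun K i => ∑ j, MvPolynomial.pderiv j (τ K i j)

lemma continuous_pderiv {φ : Plane → ℝ} (hφ : ContDiff ℝ 1 φ) (j : Fin 2) :
    Continuous (pderiv j φ) :=
  (hφ.continuous_fderiv one_ne_zero).clm_apply continuous_const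

lemma IsTest.contDiff_one {φ : Plane → ℝ} (h : IsTest Ω φ) : ContDiff ℝ 1 φ :=
  h.1.of_le (by simp)

lemma IsTest.mono {U : Set Plane} (h : U ⊆ Ω) {φ : Plane → ℝ} (hφ : IsTest U φ) : IsTest Ω φ :=
  ⟨hφ.1, hφ.2.1, hφ.2.2.trans h⟩

lemma IsTest.eq_zero {φ : Plane → ℝ} (hφ : IsTest Ω φ) {x : Plane} (hx : x ∉ Ω) : φ x = 0 :=
  image_eq_zero_of_notMem_tsupport fun h => hx (hφ.2.2 h)

lemma pderiv_pval_mul (p : Poly) {φ : Plane → ℝ} (hφ : ContDiff ℝ 1 φ) (j : Fin 2) (x : Plane) :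
    pderiv j (fun x => pval p x * φ x) x =
      pval p x * pderiv j φ x + pval (MvPolynomial.pderiv j p) x * φ x := by
  rw [← pderiv_pval]
  simp only [pderiv]
  rw [fderiv_fun_mul (by fun_prop) (hφ.differentiable one_ne_zero x)]
  simp [mul_comm]

lemma integral_scalFun_mul_pderiv (hΩ : IsPolygonal Ω) (T : Triangulation Ω) (u : T.cells → Poly)
    {φ : Plane → ℝ} (hφ : ContDiff ℝ 1 φ) (j : Fin 2) :
    (∫ x in Ω, scalFun T u x * pderiv j φ x) +
        ∫ x in Ω, scalFun T (fun K => MvPolynomial.pderiv j (u K)) x * φ x =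
      ∑ K : T.cells, ∫ x in K.1.body, pderiv j (fun x => pval (u K) x * φ x) x := by
  have hcont := hφ.continuous
  have hcont' := continuous_pderiv hφ j
  rw [T.integral_eq_sum hΩ (g := fun K x => pval (u K) x * pderiv j φ x) (fun K => by fun_prop)
      (fun K x hx => by simp only [scalFun_eq T _ K hx]),
    T.integral_eq_sum hΩ (g := fun K x => pval (MvPolynomial.pderiv j (u K)) x * φ x)
      (fun K => by fun_prop) (fun K x hx => by simp only [scalFun_eq T _ K hx]),
    ← Finset.sum_add_distrib]
  refine Finset.sum_congr rfl fun K _ => ?_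
  simp only [pderiv_pval_mul _ hφ]
  exact (integral_add (K.1.integrableOn_body (by fun_prop))
    (K.1.integrableOn_body (by fun_prop))).symm

lemma memH1_of_forall (hΩ : IsPolygonal Ω) (T : Triangulation Ω) (u : T.cells → Poly)
    (h : ∀ φ, IsTest Ω φ → ∀ j,
      ∑ K : T.cells, ∫ x in K.1.body, pderiv j (fun x => pval (u K) x * φ x) x = 0) :
    MemH1 Ω (scalFun T u) :=
  ⟨memL2_scalFun T Ω u, fun j => ⟨_, memL2_scalFun T Ω _, fun φ hφ => eq_neg_of_add_eq_zero_left
    ((integral_scalFun_mul_pderiv hΩ T u hφ.contDiff_one j).trans (h φ hφ j))⟩⟩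

lemma integral_matFun_mul_pderiv (hΩ : IsPolygonal Ω) (T : Triangulation Ω) (τ : MatField T)
    {φ : Plane → ℝ} (hφ : ContDiff ℝ 1 φ) (i : Fin 2) :
    (∫ x in Ω, ∑ j, matFun T τ x i j * pderiv j φ x) +
        ∫ x in Ω, vecFun T (pdiv T τ) x i * φ x =
      ∑ K : T.cells, ∑ j, ∫ x in K.1.body, pderiv j (fun x => pval (τ K i j) x * φ x) x := by
  have hcont := hφ.continuous
  have hcont' (j) := continuous_pderiv hφ j
  have hdiv : EqOn (fun x => vecFun T (pdiv T τ) x i * φ x)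
      (fun x => ∑ j, scalFun T (fun K => MvPolynomial.pderiv j (τ K i j)) x * φ x)
      T.openCells := fun x hx => by
    obtain ⟨K, hK⟩ := mem_iUnion.1 hx
    simp only [vecFun_apply, scalFun_eq T _ K hK, pdiv, pval_sum, Finset.sum_mul]
  rw [Finset.sum_comm, ← T.restrict_openCells hΩ,
    setIntegral_congr_fun T.isOpen_openCells.measurableSet hdiv, T.restrict_openCells hΩ,
    integral_finsetSum _ fun j _ => ?_, integral_finsetSum _ fun j _ => ?_,
    ← Finset.sum_add_distrib]
  · simp only [matFun_apply, integral_scalFun_mul_pderiv hΩ T _ hφ]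
  · exact T.integrableOn hΩ (g := fun K x => pval (MvPolynomial.pderiv j (τ K i j)) x * φ x)
      (fun K => by fun_prop) (fun K x hx => by simp only [scalFun_eq T _ K hx])
  · exact T.integrableOn hΩ (g := fun K x => pval (τ K i j) x * pderiv j φ x)
      (fun K => by fun_prop) (fun K x hx => by simp only [matFun_apply, scalFun_eq T _ K hx])

lemma isWeakDiv_of_forall (hΩ : IsPolygonal Ω) (T : Triangulation Ω) (τ : MatField T)
    (h : ∀ φ, IsTest Ω φ → ∀ i, ∑ K : T.cells, ∑ j,
      ∫ x in K.1.body, pderiv j (fun x => pval (τ K i j) x * φ x) x = 0) :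
    IsWeakDiv Ω (matFun T τ) (vecFun T (pdiv T τ)) := fun φ hφ i =>
  eq_neg_of_add_eq_zero_left
    ((integral_matFun_mul_pderiv hΩ T τ hφ.contDiff_one i).trans (h φ hφ i))

lemma contDiff_pval_mul (p : Poly) {φ : Plane → ℝ} (hφ : ContDiff ℝ 1 φ) :
    ContDiff ℝ 1 fun x => pval p x * φ x :=
  (contDiff_pval p).mul hφ

lemma isWeakDiv_openCells (hΩ : IsPolygonal Ω) (T : Triangulation Ω) (τ : MatField T) :
    IsWeakDiv T.openCells (matFun T τ) (vecFun T (pdiv T τ)) := by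
  intro φ hφ i
  have hedge (K : T.cells) (l : Fin 3) (p : Poly) :
      K.1.edgeMean l (fun x => pval p x * φ x) = 0 := by
    refine (intervalIntegral.integral_congr fun t ht => ?_).trans intervalIntegral.integral_zero
    rw [uIcc_of_le zero_le_one] at ht
    have hx : AffineMap.lineMap (K.1.points (l + 1)) (K.1.points (l + 2)) t ∈
        segment ℝ (K.1.points (l + 1)) (K.1.points (l + 2)) := by
      rw [segment_eq_image_lineMap]
      exact mem_image_of_mem _ ht
    have hzero := K.1.bary_eq_zero_of_mem_segment (j := l) (by simp) (by simp) hx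
    have hx' := fun h =>
      (T.bary_pos_of_mem_openCells h (K.1.segment_subset_body _ _ hx) l).ne' hzero
    simp [hφ.eq_zero hx']
  rw [T.restrict_openCells hΩ]
  refine eq_neg_of_add_eq_zero_left ((integral_matFun_mul_pderiv hΩ T τ hφ.contDiff_one i).trans ?_)
  simp only [Triangle.green _ (contDiff_pval_mul _ hφ.contDiff_one), hedge, mul_zero,
    Finset.sum_const_zero, neg_zero]

lemma MemL2.integrable_mul {U : Set Plane} {u φ : Plane → ℝ} (hu : MemL2 U u) (hφ : Continuous φ)
    (hc : HasCompactSupport φ) : Integrable (fun x => u x * φ x) (volume.restrict U) := by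
  simpa only [smul_eq_mul, mul_comm] using
    (hu.locallyIntegrable (by norm_num)).integrable_smul_left_of_hasCompactSupport hφ hc

lemma IsWeakDiv.ae_eq {U : Set Plane} (hU : IsOpen U) {τ : Plane → Matrix (Fin 2) (Fin 2) ℝ}
    {g g' : Plane → Fin 2 → ℝ} (hg : MemL2Vec U g) (hg' : MemL2Vec U g') (h : IsWeakDiv U τ g)
    (h' : IsWeakDiv U τ g') : g =ᵐ[volume.restrict U] g' := by
  have hcomp (i : Fin 2) : ∀ᵐ x ∂volume.restrict U, x ∈ U → g x i - g' x i = 0 := by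
    have hloc {w : Plane → Fin 2 → ℝ} (hw : MemL2Vec U w) :
        LocallyIntegrable (fun x => w x i) (volume.restrict U) :=
      (hw i).locallyIntegrable (by norm_num)
    refine hU.ae_eq_zero_of_integral_contDiff_smul_eq_zero
      (((hloc hg).sub (hloc hg')).locallyIntegrableOn U) fun φ hsmooth hcomp hsupp => ?_
    have hφ : IsTest U φ := ⟨hsmooth, hcomp, hsupp⟩
    have heq := (h φ hφ i).symm.trans (h' φ hφ i)
    simp only [smul_eq_mul, mul_comm (φ _), sub_mul]
    rw [integral_sub ((hg i).integrable_mul hφ.1.continuous hφ.2.1)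
      ((hg' i).integrable_mul hφ.1.continuous hφ.2.1), sub_eq_zero]
    exact neg_injective heq
  filter_upwards [ae_all_iff.2 hcomp, ae_restrict_mem hU.measurableSet] with x hx hxU
  exact funext fun i => sub_eq_zero.1 (hx i hxU)

lemma memL2Vec_vecFun (T : Triangulation Ω) (U : Set Plane) (v : VecField T) :
    MemL2Vec U (vecFun T v) := fun i => by
  simpa only [vecFun_apply] using memL2_scalFun T U _

lemma weakDiv_ae_eq (hΩ : IsPolygonal Ω) (T : Triangulation Ω) {τ : MatField T}
    (h : MemHDiv Ω (matFun T τ)) :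
    weakDiv Ω (matFun T τ) =ᵐ[volume.restrict Ω] vecFun T (pdiv T τ) := by
  rw [weakDiv, dif_pos h.2.2]
  obtain ⟨hL2, hdiv⟩ := h.2.2.choose_spec
  generalize h.2.2.choose = g at hL2 hdiv ⊢
  rw [← T.restrict_openCells hΩ]
  refine IsWeakDiv.ae_eq T.isOpen_openCells ?_ (memL2Vec_vecFun T _ _) (fun φ hφ i => ?_)
    (isWeakDiv_openCells hΩ T τ)
  · simpa only [MemL2Vec, MemL2, T.restrict_openCells hΩ] using hL2
  · rw [T.restrict_openCells hΩ]
    exact hdiv φ (hφ.mono (T.openCells_subset hΩ)) i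

lemma eq_of_pval_ae_eq {U : Set Plane} (hU : IsOpen U) (hne : U.Nonempty) {p q : Poly}
    (h : pval p =ᵐ[volume.restrict U] pval q) : p = q := by
  refine sub_eq_zero.1 (eq_zero_of_pval_eq_zero hU hne fun x hx => ?_)
  rw [pval_sub, sub_eq_zero]
  exact Measure.eqOn_open_of_ae_eq h hU (continuous_pval p).continuousOn
    (continuous_pval q).continuousOn hx

lemma vecFun_injective (hΩ : IsPolygonal Ω) (T : Triangulation Ω) {v w : VecField T}
    (h : vecFun T v =ᵐ[volume.restrict Ω] vecFun T w) : v = w := by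
  ext1 K
  ext1 i
  refine eq_of_pval_ae_eq isOpen_interior K.1.interior_nonempty ?_
  filter_upwards [ae_restrict_of_ae_restrict_of_subset (T.interior_subset hΩ K) h,
    ae_restrict_mem isOpen_interior.measurableSet] with x hx hxK
  simpa only [vecFun_apply, scalFun_eq T _ K hxK] using congrFun hx i

/-! ### Rigid motions -/

section PartialDerivatives

variable {σ R : Type*} [CommSemiring R]

lemma pderiv_comm (i j : σ) (p : MvPolynomial σ R) :
    MvPolynomial.pderiv i (MvPolynomial.pderiv j p) =
      MvPolynomial.pderiv j (MvPolynomial.pderiv i p) := by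
  classical
  ext m
  simp only [MvPolynomial.coeff_pderiv]
  rcases eq_or_ne i j with rfl | h
  · rfl
  · simp only [add_right_comm, Finsupp.add_apply, Finsupp.single_eq_of_ne h,
      Finsupp.single_eq_of_ne h.symm, add_zero, mul_right_comm]

lemma eq_C_of_pderiv_eq_zero [NoZeroDivisors R] [CharZero R] {p : MvPolynomial σ R}
    (h : ∀ i, MvPolynomial.pderiv i p = 0) : p = MvPolynomial.C (MvPolynomial.coeff 0 p) := by
  classical
  ext m
  rw [MvPolynomial.coeff_C]
  split_ifs with hm
  · rw [hm]
  · obtain ⟨i, hi⟩ : ∃ i, m i ≠ 0 := by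
      by_contra! hc
      exact hm (Finsupp.ext fun i => (hc i).symm)
    have hm' : m - Finsupp.single i 1 + Finsupp.single i 1 = m :=
      tsub_add_cancel_of_le (by simpa using Nat.one_le_iff_ne_zero.2 hi)
    have hcoeff := MvPolynomial.coeff_pderiv (i := i) p (m - Finsupp.single i 1)
    rw [h i, hm', MvPolynomial.coeff_zero] at hcoeff
    exact (mul_eq_zero.1 hcoeff.symm).resolve_right (Nat.cast_add_one_ne_zero _)

end PartialDerivatives

/-- Rigid motions: polynomial vector fields with vanishing symmetric gradient. -/
def IsRigid (w : Fin 2 → Poly) : Prop :=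
  ∀ i j, MvPolynomial.pderiv i (w j) + MvPolynomial.pderiv j (w i) = 0

namespace IsRigid

variable {v w : Fin 2 → Poly}

lemma pderiv_self (h : IsRigid w) (i : Fin 2) : MvPolynomial.pderiv i (w i) = 0 :=
  add_self_eq_zero.1 (h i i)

lemma exists_eq (h : IsRigid w) :
    ∃ a b e : ℝ, w 0 = MvPolynomial.C a + MvPolynomial.C e * MvPolynomial.X 1 ∧
      w 1 = MvPolynomial.C b - MvPolynomial.C e * MvPolynomial.X 0 := by
  have h01 : MvPolynomial.pderiv 0 (w 1) = -MvPolynomial.pderiv 1 (w 0) :=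
    eq_neg_of_add_eq_zero_left (h 0 1)
  obtain ⟨e, he⟩ : ∃ e, MvPolynomial.pderiv 1 (w 0) = MvPolynomial.C e := by
    refine ⟨_, eq_C_of_pderiv_eq_zero (Fin.forall_fin_two.2 ⟨?_, ?_⟩)⟩
    · rw [pderiv_comm, h.pderiv_self, map_zero]
    · rw [← neg_eq_zero, ← map_neg, ← h01, pderiv_comm, h.pderiv_self, map_zero]
  obtain ⟨a, h0⟩ : ∃ a, w 0 - MvPolynomial.C e * MvPolynomial.X 1 = MvPolynomial.C a := by
    refine ⟨_, eq_C_of_pderiv_eq_zero (Fin.forall_fin_two.2 ⟨?_, ?_⟩)⟩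
    · simp [h.pderiv_self, MvPolynomial.pderiv_X]
    · simp [he]
  obtain ⟨b, h1⟩ : ∃ b, w 1 + MvPolynomial.C e * MvPolynomial.X 0 = MvPolynomial.C b := by
    refine ⟨_, eq_C_of_pderiv_eq_zero (Fin.forall_fin_two.2 ⟨?_, ?_⟩)⟩
    · simp [h01, he]
    · simp [h.pderiv_self, MvPolynomial.pderiv_X]
  exact ⟨a, b, e, sub_eq_iff_eq_add.1 h0, eq_sub_of_add_eq h1⟩

lemma totalDegree_le (h : IsRigid w) (i : Fin 2) : (w i).totalDegree ≤ 1 := by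
  obtain ⟨a, b, e, h0, h1⟩ := h.exists_eq
  have hlin (l : Fin 2) : (MvPolynomial.C e * MvPolynomial.X l : Poly).totalDegree ≤ 1 :=
    (MvPolynomial.totalDegree_mul _ _).trans
      (by rw [MvPolynomial.totalDegree_C, MvPolynomial.totalDegree_X])
  revert i
  rw [Fin.forall_fin_two, h0, h1]
  exact ⟨(MvPolynomial.totalDegree_add _ _).trans (max_le (by simp) (hlin 1)),
    (MvPolynomial.totalDegree_sub _ _).trans (max_le (by simp) (hlin 0))⟩

lemma sub (hv : IsRigid v) (hw : IsRigid w) : IsRigid (v - w) := fun i j => by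
  simp only [Pi.sub_apply, map_sub]
  linear_combination hv i j - hw i j

lemma eq_zero (h : IsRigid w) {x y : Plane} (hxy : x ≠ y) (hx : ∀ i, pval (w i) x = 0)
    (hy : ∀ i, pval (w i) y = 0) : w = 0 := by
  obtain ⟨a, b, e, h0, h1⟩ := h.exists_eq
  simp only [Fin.forall_fin_two, h0, h1, pval_add, pval_sub, pval_mul, pval_C, pval_X] at hx hy
  obtain rfl : e = 0 := by
    by_contra he
    refine hxy (PiLp.ext (Fin.forall_fin_two.2 ⟨mul_left_cancel₀ he ?_, mul_left_cancel₀ he ?_⟩))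
    · linarith
    · linarith
  obtain rfl : a = 0 := by linarith
  obtain rfl : b = 0 := by linarith
  exact funext (Fin.forall_fin_two.2 ⟨by simp [h0], by simp [h1]⟩)

lemma sum_mul_pderiv (hw : IsRigid w) {τ : Matrix (Fin 2) (Fin 2) Poly} (hτ : τ.IsSymm) :
    ∑ i, ∑ l, τ i l * MvPolynomial.pderiv l (w i) = 0 := by
  simp only [Fin.sum_univ_two, hw.pderiv_self, hτ.apply 0 1]
  linear_combination τ 0 1 * hw 0 1

end IsRigid

/-! ### Integration by parts on one triangle -/

namespace Triangle

variable (K : Triangle)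

lemma edgeMean_eq_zero (j : Fin 3) {F : Plane → ℝ}
    (h : ∀ x ∈ openSegment ℝ (K.points (j + 1)) (K.points (j + 2)), F x = 0) :
    K.edgeMean j F = 0 := by
  rw [edgeMean, segmentMean, intervalIntegral.integral_of_le zero_le_one,
    integral_Ioc_eq_integral_Ioo]
  refine setIntegral_eq_zero_of_forall_eq_zero fun t ht => h _ ?_
  rw [openSegment_eq_image_lineMap]
  exact mem_image_of_mem _ ht

lemma edgeMean_sum_mul {ι : Type*} (s : Finset ι) (j : Fin 3) (c : ι → ℝ) {F : ι → Plane → ℝ}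
    (hF : ∀ l, Continuous (F l)) :
    K.edgeMean j (fun x => ∑ l ∈ s, c l * F l x) = ∑ l ∈ s, c l * K.edgeMean j (F l) := by
  simp only [edgeMean, segmentMean, ← intervalIntegral.integral_const_mul]
  refine intervalIntegral.integral_finsetSum fun l _ => IntervalIntegrable.const_mul ?_ (c l)
  exact ((hF l).comp AffineMap.lineMap_continuous).intervalIntegrable 0 1

lemma green_vec {F : Fin 2 → Plane → ℝ} (hF : ∀ l, ContDiff ℝ 1 (F l)) :
    ∑ l, ∫ x in K.body, pderiv l (F l) x =
      -∑ j, K.edgeMean j fun x => ∑ l, K.inwardNormal j l * F l x := by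
  simp only [K.green (hF _), K.edgeMean_sum_mul _ _ _ fun l => (hF l).continuous,
    Finset.sum_neg_distrib]
  rw [Finset.sum_comm]

/-- The factors of `w i` are grouped so that the boundary term vanishes for `τ ν = 0`, and the last
term for a symmetric `τ` and a rigid motion `w`. -/
lemma green_div (τ : Matrix (Fin 2) (Fin 2) Poly) (w : Fin 2 → Poly) :
    ∫ x in K.body, pval (∑ i, (∑ l, MvPolynomial.pderiv l (τ i l)) * w i) x =
      -(∑ j, K.edgeMean j
          fun x => ∑ i, (∑ l, K.inwardNormal j l * pval (τ i l) x) * pval (w i) x)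
      - ∫ x in K.body, pval (∑ i, ∑ l, τ i l * MvPolynomial.pderiv l (w i)) x := by
  have hgreen := K.green_vec (F := fun l => pval (∑ i, τ i l * w i)) fun l => contDiff_pval _
  have hedge (j : Fin 3) (x : Plane) :
      ∑ l, K.inwardNormal j l * pval (∑ i, τ i l * w i) x =
        ∑ i, (∑ l, K.inwardNormal j l * pval (τ i l) x) * pval (w i) x := by
    simp only [Fin.sum_univ_two, pval_add, pval_mul]
    ring
  simp only [hedge] at hgreen
  have hintegrable (p : Poly) : IntegrableOn (pval p) K.body := K.integrableOn_body (by fun_prop)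
  simp only [pderiv_pval] at hgreen
  rw [← hgreen, ← integral_finsetSum _ fun l _ => hintegrable _,
    ← integral_sub (integrable_finsetSum _ fun l _ => hintegrable _) (hintegrable _)]
  congr 1
  ext x
  simp only [Fin.sum_univ_two, pval_add, pval_mul, map_add, Derivation.leibniz, smul_eq_mul]
  ring

end Triangle

/-- The normal component of the matrix polynomial `τ` vanishes on `∂K`. -/
def NormalZero (K : Triangle) (τ : Matrix (Fin 2) (Fin 2) Poly) : Prop :=
  ∀ (j : Fin 3) (i : Fin 2), ∀ x ∈ segment ℝ (K.points (j + 1)) (K.points (j + 2)),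
    ∑ l, K.inwardNormal j l * pval (τ i l) x = 0

namespace NormalZero

variable {K : Triangle} {τ : Matrix (Fin 2) (Fin 2) Poly}

lemma green (h : NormalZero K τ) {φ : Plane → ℝ} (hφ : ContDiff ℝ 1 φ) (i : Fin 2) :
    ∑ l, ∫ x in K.body, pderiv l (fun x => pval (τ i l) x * φ x) x = 0 := by
  rw [K.green_vec (F := fun l x => pval (τ i l) x * φ x) fun l => contDiff_pval_mul _ hφ,
    neg_eq_zero]
  refine Finset.sum_eq_zero fun j _ => K.edgeMean_eq_zero j fun x hx => ?_
  simp only [← mul_assoc, ← Finset.sum_mul, h j i x (openSegment_subset_segment ℝ _ _ hx),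
    zero_mul]

lemma green_div (h : NormalZero K τ) (w : Fin 2 → Poly) :
    ∫ x in K.body, pval (∑ i, (∑ l, MvPolynomial.pderiv l (τ i l)) * w i) x =
      -∫ x in K.body, pval (∑ i, ∑ l, τ i l * MvPolynomial.pderiv l (w i)) x := by
  rw [K.green_div, Finset.sum_eq_zero, neg_zero, zero_sub]
  refine fun j _ => K.edgeMean_eq_zero j fun x hx => ?_
  simp only [h j _ x (openSegment_subset_segment ℝ _ _ hx), zero_mul, Finset.sum_const_zero]

lemma of_mem_bubbleS {k : ℕ} (h : τ ∈ BubbleS k K) : NormalZero K τ := by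
  intro j i x hx
  have hnormal : inner ℝ (WithLp.toLp 2 (K.inwardNormal j))
      (K.points (j + 2) - K.points (j + 1)) = 0 := by
    simp only [PiLp.inner_apply, Fin.sum_univ_two, PiLp.sub_apply, RCLike.inner_apply,
      conj_trivial, Triangle.inwardNormal, Triangle.baryGrad]
    simp
    ring
  have hrow := congrFun (h.2 (j + 1) (j + 2) (by simp) x hx _ hnormal) i
  simpa only [mval, Matrix.mulVec, dotProduct, Matrix.of_apply, Pi.zero_apply, mul_comm]
    using hrow

lemma bubble_smul (K : Triangle) (q : Matrix (Fin 2) (Fin 2) Poly) :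
    NormalZero K (K.bubble • q) := by
  intro j i x hx
  have hbary : pval (K.bary j) x = 0 := K.bary_eq_zero_of_mem_segment (by simp) (by simp) hx
  have hbubble : pval K.bubble x = 0 := by
    simp only [Triangle.bubble, pval_mul]
    fin_cases j <;> simp_all
  simp [hbubble]

end NormalZero

/-! ### Edge bubbles and rigid motions -/

/-- The bilinear form `(a, b) ↦ a · (∇w) b`; the field `w` is a rigid motion if and only if this
form is alternating. -/
def gradForm (w : Fin 2 → Poly) : Plane →ₗ[ℝ] Plane →ₗ[ℝ] Poly :=
  LinearMap.mk₂ ℝ (fun a b => ∑ i, ∑ l, (a i * b l) • MvPolynomial.pderiv l (w i))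
    (by intros; simp [add_mul, add_smul, Finset.sum_add_distrib])
    (by intros; simp [mul_assoc, mul_smul])
    (by intros; simp [mul_add, add_smul, Finset.sum_add_distrib])
    (by intros; simp [mul_left_comm, mul_smul])

lemma gradForm_apply (w : Fin 2 → Poly) (a b : Plane) :
    gradForm w a b = ∑ i, ∑ l, (a i * b l) • MvPolynomial.pderiv l (w i) := rfl

lemma gradForm_single (w : Fin 2 → Poly) (i l : Fin 2) :
    gradForm w (EuclideanSpace.single i 1) (EuclideanSpace.single l 1) =
      MvPolynomial.pderiv l (w i) := by
  simp [gradForm_apply, PiLp.single_apply]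

lemma totalDegree_gradForm_le {w : Fin 2 → Poly} {n : ℕ} (hw : ∀ i, (w i).totalDegree ≤ n)
    (a b : Plane) : (gradForm w a b).totalDegree ≤ n - 1 :=
  MvPolynomial.totalDegree_finsetSum_le fun i _ =>
    MvPolynomial.totalDegree_finsetSum_le fun _ _ =>
      (MvPolynomial.totalDegree_smul_le _ _).trans
        ((totalDegree_pderiv_le _ _).trans (Nat.sub_le_sub_right (hw i) 1))

namespace Triangle

variable (K : Triangle)

lemma integral_pval_eq_zero {p : Poly} (hp : ∀ x ∈ K.body, 0 ≤ pval p x)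
    (h : ∫ x in K.body, pval p x = 0) : p = 0 := by
  rw [setIntegral_eq_zero_iff_of_nonneg_ae
    ((ae_restrict_iff' K.measurableSet_body).2 (.of_forall hp))
    (K.integrableOn_body (continuous_pval p))] at h
  refine eq_of_pval_ae_eq isOpen_interior K.interior_nonempty ?_
  filter_upwards [ae_restrict_of_ae_restrict_of_subset interior_subset h] with x hx
  simpa using hx

/-- The tangent vector of the edge opposite to the vertex `j`, with the length of that edge. -/
def edgeVector (j : Fin 3) : Plane := K.points (j + 2) - K.points (j + 1)

/-- The bubble `λ_p λ_q g t tᵀ` that belongs to the edge `[p, q]` opposite to the vertex `j`, where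
`t` is the tangent vector. -/
def edgeBubble (j : Fin 3) (g : Poly) : Matrix (Fin 2) (Fin 2) Poly :=
  Matrix.of fun a b =>
    (K.edgeVector j a * K.edgeVector j b) • (K.bary (j + 1) * K.bary (j + 2) * g)

lemma edgeBubble_isSymm (j : Fin 3) (g : Poly) : (K.edgeBubble j g).IsSymm :=
  Matrix.IsSymm.ext fun a b => by simp only [edgeBubble, Matrix.of_apply, mul_comm]

lemma totalDegree_bary_mul_le (i j : Fin 3) {k : ℕ} (hk : 2 ≤ k) {g : Poly}
    (hg : g.totalDegree ≤ k - 2) : (K.bary i * K.bary j * g).totalDegree ≤ k := by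
  have h1 := MvPolynomial.totalDegree_mul (K.bary i * K.bary j) g
  have h2 := MvPolynomial.totalDegree_mul (K.bary i) (K.bary j)
  have h3 := K.totalDegree_bary i
  have h4 := K.totalDegree_bary j
  omega

/-- Off the edge opposite to `j` the factor `λ_p λ_q` vanishes; on it `ν` is orthogonal to `t`. -/
lemma bary_mul_bary_mul_inner_edgeVector {i i' : Fin 3} (hii' : i ≠ i') (j : Fin 3) {x ν : Plane}
    (hx : x ∈ segment ℝ (K.points i) (K.points i'))
    (hν : inner ℝ ν (K.points i' - K.points i) = 0) :
    pval (K.bary (j + 1)) x * pval (K.bary (j + 2)) x * inner ℝ ν (K.edgeVector j) = 0 := by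
  by_cases h1 : i ≠ j + 1 ∧ i' ≠ j + 1
  · simp [K.bary_eq_zero_of_mem_segment h1.1 h1.2 hx]
  by_cases h2 : i ≠ j + 2 ∧ i' ≠ j + 2
  · simp [K.bary_eq_zero_of_mem_segment h2.1 h2.2 hx]
  have h3 : (i = j + 1 ∧ i' = j + 2) ∨ (i = j + 2 ∧ i' = j + 1) := by
    clear hν hx
    revert i i' j
    decide
  rcases h3 with ⟨rfl, rfl⟩ | ⟨rfl, rfl⟩
  · rw [edgeVector, hν, mul_zero]
  · rw [edgeVector, ← neg_sub, inner_neg_right, hν, neg_zero, mul_zero]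

lemma edgeBubble_mem_bubbleS (j : Fin 3) {k : ℕ} (hk : 2 ≤ k) {g : Poly}
    (hg : g.totalDegree ≤ k - 2) : K.edgeBubble j g ∈ BubbleS k K := by
  refine ⟨⟨K.edgeBubble_isSymm j g, fun a b => ?_⟩, fun i i' hii' x hx ν hν => ?_⟩
  · exact (MvPolynomial.totalDegree_smul_le _ _).trans (K.totalDegree_bary_mul_le _ _ hk hg)
  · have hzero := K.bary_mul_bary_mul_inner_edgeVector hii' j hx hν
    ext a
    simp only [PiLp.inner_apply, RCLike.inner_apply, conj_trivial, mval, edgeBubble,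
      Matrix.mulVec, dotProduct, Matrix.of_apply, Pi.zero_apply, pval_mul, pval_smul,
      Fin.sum_univ_two] at hzero ⊢
    linear_combination pval g x * K.edgeVector j a * hzero

/-- The strain of `w` along the edge opposite to the vertex `j`. -/
def edgeStrain (j : Fin 3) (w : Fin 2 → Poly) : Poly := gradForm w (K.edgeVector j) (K.edgeVector j)

lemma sum_edgeBubble_mul_pderiv (j : Fin 3) (g : Poly) (w : Fin 2 → Poly) :
    ∑ i, ∑ l, K.edgeBubble j g i l * MvPolynomial.pderiv l (w i) =
      K.bary (j + 1) * K.bary (j + 2) * g * K.edgeStrain j w := by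
  simp only [edgeBubble, Matrix.of_apply, edgeStrain, gradForm_apply, Finset.mul_sum,
    smul_mul_assoc, mul_smul_comm]

lemma edgeStrain_eq_zero (j : Fin 3) {w : Fin 2 → Poly}
    (h : ∫ x in K.body, pval (∑ i, (∑ l, MvPolynomial.pderiv l
      (K.edgeBubble j (K.edgeStrain j w) i l)) * w i) x = 0) :
    K.edgeStrain j w = 0 := by
  have hnormal : NormalZero K (K.edgeBubble j (K.edgeStrain j w)) :=
    NormalZero.of_mem_bubbleS (k := (K.edgeStrain j w).totalDegree + 2)
      (K.edgeBubble_mem_bubbleS j (by omega) (by omega))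
  rw [hnormal.green_div, neg_eq_zero, sum_edgeBubble_mul_pderiv] at h
  have hprod := K.integral_pval_eq_zero (fun x hx => ?_) h
  · simpa [K.bary_ne_zero] using hprod
  · rw [K.body_eq] at hx
    rw [mul_assoc, pval_mul, pval_mul, pval_mul]
    exact mul_nonneg (mul_nonneg (hx _) (hx _)) (mul_self_nonneg _)

/-- By polarization, as two of the edge vectors form a basis and the third is their difference. -/
lemma isRigid_of_edgeStrain {w : Fin 2 → Poly} (h : ∀ j, K.edgeStrain j w = 0) : IsRigid w := by
  set u := K.points 1 - K.points 0 with hu_def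
  set v := K.points 2 - K.points 0 with hv_def
  have hu : gradForm w u u = 0 := h 2
  have hv : gradForm w v v = 0 := by
    have hstrain : gradForm w (K.points 0 - K.points 2) (K.points 0 - K.points 2) = 0 := h 1
    simpa [← neg_sub (K.points 2), ← hv_def] using hstrain
  have huv : gradForm w u v = -gradForm w v u := by
    have hstrain : gradForm w (K.points 2 - K.points 1) (K.points 2 - K.points 1) = 0 := h 0
    rw [show K.points 2 - K.points 1 = v - u by simp [hu_def, hv_def]] at hstrain
    simp only [map_sub, LinearMap.sub_apply, hu, hv] at hstrain
    linear_combination -hstrain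
  intro i j
  rw [← gradForm_single w j i, ← gradForm_single w i j, K.single_eq_baryGrad_smul i,
    K.single_eq_baryGrad_smul j, ← hu_def, ← hv_def]
  simp only [map_add, map_smul, LinearMap.add_apply, LinearMap.smul_apply, hu, hv, huv]
  module

end Triangle

/-! ### The finite element spaces as subspaces -/

lemma IsTest.continuous_pderiv {φ : Plane → ℝ} (h : IsTest Ω φ) (j : Fin 2) :
    Continuous (pderiv j φ) :=
  LumpedElasticity.continuous_pderiv h.contDiff_one j

lemma IsTest.hasCompactSupport_pderiv {φ : Plane → ℝ} (h : IsTest Ω φ) (j : Fin 2) :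
    HasCompactSupport (pderiv j φ) :=
  h.2.1.fderiv_apply (𝕜 := ℝ) _

/-- `H¹(Ω)` as a subspace of the functions on the plane. -/
def h1Submodule (Ω : Set Plane) : Submodule ℝ (Plane → ℝ) where
  carrier := {u | MemH1 Ω u}
  add_mem' {u v} hu hv := by
    refine ⟨hu.1.add hv.1, fun j => ?_⟩
    obtain ⟨g, hg, hug⟩ := hu.2 j
    obtain ⟨g', hg', hvg⟩ := hv.2 j
    refine ⟨g + g', hg.add hg', fun φ hφ => ?_⟩
    have hcont := hφ.continuous_pderiv j
    have hsupp := hφ.hasCompactSupport_pderiv j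
    simp only [Pi.add_apply, add_mul]
    rw [integral_add (hu.1.integrable_mul hcont hsupp) (hv.1.integrable_mul hcont hsupp),
      integral_add (hg.integrable_mul hφ.1.continuous hφ.2.1)
        (hg'.integrable_mul hφ.1.continuous hφ.2.1), hug φ hφ, hvg φ hφ, neg_add]
  zero_mem' := ⟨MemLp.zero, fun _ => ⟨0, MemLp.zero, by simp⟩⟩
  smul_mem' c u hu := by
    refine ⟨hu.1.const_mul c, fun j => ?_⟩
    obtain ⟨g, hg, hug⟩ := hu.2 j
    refine ⟨fun x => c * g x, hg.const_mul c, fun φ hφ => ?_⟩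
    simp only [Pi.smul_apply, smul_eq_mul, mul_assoc, integral_const_mul, hug φ hφ, mul_neg]

lemma integrable_row_mul_pderiv {τ : Plane → Matrix (Fin 2) (Fin 2) ℝ}
    (hτ : ∀ i j, MemL2 Ω fun x => τ x i j) {φ : Plane → ℝ} (hφ : IsTest Ω φ) (i : Fin 2) :
    Integrable (fun x => ∑ j, τ x i j * pderiv j φ x) (volume.restrict Ω) :=
  integrable_finsetSum _ fun j _ =>
    (hτ i j).integrable_mul (hφ.continuous_pderiv j) (hφ.hasCompactSupport_pderiv j)

/-- `H(div, Ω; 𝕊)` as a subspace of the matrix fields on the plane. -/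
def hDivSubmodule (Ω : Set Plane) : Submodule ℝ (Plane → Matrix (Fin 2) (Fin 2) ℝ) where
  carrier := {τ | MemHDiv Ω τ}
  add_mem' {σ τ} hσ hτ := by
    obtain ⟨hσs, hσ2, g, hg, hσg⟩ := hσ
    obtain ⟨hτs, hτ2, g', hg', hτg⟩ := hτ
    refine ⟨?_, fun i j => (hσ2 i j).add (hτ2 i j), g + g', fun i => (hg i).add (hg' i),
      fun φ hφ i => ?_⟩
    · filter_upwards [hσs, hτs] with x hx hx' using hx.add hx'
    · simp only [Pi.add_apply, Matrix.add_apply, add_mul, Finset.sum_add_distrib]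
      rw [integral_add (integrable_row_mul_pderiv hσ2 hφ i) (integrable_row_mul_pderiv hτ2 hφ i),
        integral_add ((hg i).integrable_mul hφ.1.continuous hφ.2.1)
          ((hg' i).integrable_mul hφ.1.continuous hφ.2.1), hσg φ hφ i, hτg φ hφ i, neg_add]
  zero_mem' := ⟨.of_forall fun _ => Matrix.isSymm_zero, fun _ _ => MemLp.zero, 0,
    fun _ => MemLp.zero, fun _ _ _ => by simp⟩
  smul_mem' c τ hτ := by
    obtain ⟨hs, h2, g, hg, hτg⟩ := hτ
    refine ⟨?_, fun i j => (h2 i j).const_mul c, c • g, fun i => (hg i).const_mul c,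
      fun φ hφ i => ?_⟩
    · filter_upwards [hs] with x hx using hx.smul c
    · simp only [Pi.smul_apply, Matrix.smul_apply, smul_eq_mul, mul_assoc, ← Finset.mul_sum,
        integral_const_mul, hτg φ hφ i, mul_neg]

lemma memHDiv_of_memH1 {τ : Plane → Matrix (Fin 2) (Fin 2) ℝ}
    (hs : ∀ᵐ x ∂(volume.restrict Ω), (τ x).IsSymm) (h : ∀ i j, MemH1 Ω fun x => τ x i j) :
    MemHDiv Ω τ := by
  choose hτ g hg hτg using h
  refine ⟨hs, hτ, fun x i => ∑ j, g i j j x, fun i => memLp_finsetSum _ fun j _ => hg i j j,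
    fun φ hφ i => ?_⟩
  simp only [Finset.sum_mul]
  rw [integral_finsetSum _ (fun j _ => (hτ i j).integrable_mul (hφ.continuous_pderiv j)
      (hφ.hasCompactSupport_pderiv j)),
    integral_finsetSum _ (fun j _ => (hg i j j).integrable_mul hφ.1.continuous hφ.2.1),
    ← Finset.sum_neg_distrib]
  exact Finset.sum_congr rfl fun j _ => hτg i j j φ hφ

lemma memHDiv_of_normalZero (hΩ : IsPolygonal Ω) (T : Triangulation Ω) {τ : MatField T}
    (hs : ∀ K, (τ K).IsSymm) (h : ∀ K, NormalZero K.1 (τ K)) : MemHDiv Ω (matFun T τ) := by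
  refine ⟨.of_forall fun x => Matrix.IsSymm.ext fun i j => ?_, fun i j => ?_,
    vecFun T (pdiv T τ), memL2Vec_vecFun T Ω _, isWeakDiv_of_forall hΩ T τ fun φ hφ i => ?_⟩
  · simp only [matFun_apply, (hs _).apply]
  · simpa only [matFun_apply] using memL2_scalFun T Ω _
  · exact Finset.sum_eq_zero fun K _ => (h K).green hφ.contDiff_one i

lemma matFun_add (T : Triangulation Ω) (σ τ : MatField T) :
    matFun T (σ + τ) = matFun T σ + matFun T τ := by
  ext x i j
  simp only [matFun_apply, Matrix.add_apply, Pi.add_apply, scalFun_add]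

lemma matFun_smul (T : Triangulation Ω) (c : ℝ) (τ : MatField T) :
    matFun T (c • τ) = c • matFun T τ := by
  ext x i j
  simp only [matFun_apply, Matrix.smul_apply, Pi.smul_apply, scalFun_smul, smul_eq_mul]

lemma matFun_zero (T : Triangulation Ω) : matFun T 0 = 0 := by
  simpa only [zero_smul] using matFun_smul T 0 0

lemma vecFun_add (T : Triangulation Ω) (v w : VecField T) :
    vecFun T (v + w) = vecFun T v + vecFun T w := by
  ext x i
  simp only [vecFun_apply, Pi.add_apply, scalFun_add]

lemma vecFun_smul (T : Triangulation Ω) (c : ℝ) (v : VecField T) :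
    vecFun T (c • v) = c • vecFun T v := by
  ext x i
  simp only [vecFun_apply, Pi.smul_apply, scalFun_smul, smul_eq_mul]

lemma mval_add (σ τ : Matrix (Fin 2) (Fin 2) Poly) (x : Plane) :
    mval (σ + τ) x = mval σ x + mval τ x := by
  ext i j
  simp [mval]

lemma mval_smul (c : ℝ) (τ : Matrix (Fin 2) (Fin 2) Poly) (x : Plane) :
    mval (c • τ) x = c • mval τ x := by
  ext i j
  simp [mval]

lemma mval_zero (x : Plane) : mval 0 x = 0 := by
  ext i j
  simp [mval]

lemma totalDegree_add_le {p q : Poly} {m : ℕ} (hp : p.totalDegree ≤ m) (hq : q.totalDegree ≤ m) :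
    (p + q).totalDegree ≤ m :=
  (MvPolynomial.totalDegree_add _ _).trans (max_le hp hq)

lemma totalDegree_smul_le_of_le {p : Poly} {m : ℕ} (hp : p.totalDegree ≤ m) (c : ℝ) :
    (c • p).totalDegree ≤ m :=
  (MvPolynomial.totalDegree_smul_le _ _).trans hp

/-- `P_m(K; 𝕊)` as a subspace. -/
def polySSubmodule (m : ℕ) : Submodule ℝ (Matrix (Fin 2) (Fin 2) Poly) where
  carrier := PolyS m
  add_mem' hσ hτ := ⟨hσ.1.add hτ.1, fun i j => totalDegree_add_le (hσ.2 i j) (hτ.2 i j)⟩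
  zero_mem' := ⟨Matrix.isSymm_zero, by simp⟩
  smul_mem' c _ hτ := ⟨hτ.1.smul c, fun i j => totalDegree_smul_le_of_le (hτ.2 i j) c⟩

/-- The cell bubble space `B_{k,K}` as a subspace. -/
def bubbleSSubmodule (k : ℕ) (K : Triangle) : Submodule ℝ (Matrix (Fin 2) (Fin 2) Poly) where
  carrier := BubbleS k K
  add_mem' hσ hτ := ⟨(polySSubmodule k).add_mem hσ.1 hτ.1, fun i j hij x hx ν hν => by
    rw [mval_add, Matrix.add_mulVec, hσ.2 i j hij x hx ν hν, hτ.2 i j hij x hx ν hν, add_zero]⟩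
  zero_mem' := ⟨(polySSubmodule k).zero_mem, fun _ _ _ _ _ _ _ => by
    rw [mval_zero, Matrix.zero_mulVec]⟩
  smul_mem' c _ hτ := ⟨(polySSubmodule k).smul_mem c hτ.1, fun i j hij x hx ν hν => by
    rw [mval_smul, Matrix.smul_mulVec, hτ.2 i j hij x hx ν hν, smul_zero]⟩

variable (k k' : ℕ) (T : Triangulation Ω)

/-- `Σ̃_{k,h}` as a subspace. -/
def sigmaTildeSubmodule : Submodule ℝ (MatField T) where
  carrier := SigmaTilde k T
  add_mem' hσ hτ := by
    refine ⟨fun i j => ?_, fun K => (polySSubmodule k).add_mem (hσ.2 K) (hτ.2 K)⟩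
    rw [matFun_add]
    exact (h1Submodule Ω).add_mem (hσ.1 i j) (hτ.1 i j)
  zero_mem' := by
    refine ⟨fun i j => ?_, fun _ => (polySSubmodule k).zero_mem⟩
    rw [matFun_zero]
    exact (h1Submodule Ω).zero_mem
  smul_mem' c τ hτ := by
    refine ⟨fun i j => ?_, fun K => (polySSubmodule k).smul_mem c (hτ.2 K)⟩
    rw [matFun_smul]
    exact (h1Submodule Ω).smul_mem c (hτ.1 i j)

/-- `B_{k,h}` as a subspace. -/
def bubbleSubmodule : Submodule ℝ (MatField T) where
  carrier := BubbleSpace k T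
  add_mem' hσ hτ := by
    refine ⟨?_, fun K => (bubbleSSubmodule k K.1).add_mem (hσ.2 K) (hτ.2 K)⟩
    rw [matFun_add]
    exact (hDivSubmodule Ω).add_mem hσ.1 hτ.1
  zero_mem' := by
    refine ⟨?_, fun K => (bubbleSSubmodule k K.1).zero_mem⟩
    rw [matFun_zero]
    exact (hDivSubmodule Ω).zero_mem
  smul_mem' c τ hτ := by
    refine ⟨?_, fun K => (bubbleSSubmodule k K.1).smul_mem c (hτ.2 K)⟩
    rw [matFun_smul]
    exact (hDivSubmodule Ω).smul_mem c hτ.1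

/-- `Λ_{k,k'}` as a subspace. -/
def enrichSubmodule : Submodule ℝ (MatField T) where
  carrier := Enrich k k' T
  add_mem' hσ hτ := by
    refine ⟨?_, fun K => ?_⟩
    · rw [matFun_add]
      exact (hDivSubmodule Ω).add_mem hσ.1 hτ.1
    · obtain ⟨q, hq, hσq⟩ := hσ.2 K
      obtain ⟨r, hr, hτr⟩ := hτ.2 K
      refine ⟨q + r, fun n => ⟨(hq n).1.add (hr n).1, fun i j =>
        ((hq n).2 i j).add ((hr n).2 i j)⟩, ?_⟩
      simp only [Pi.add_apply, hσq, hτr, Finset.sum_add_distrib, smul_add]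
  zero_mem' := by
    refine ⟨?_, fun K => ⟨0, fun n => ⟨Matrix.isSymm_zero, fun _ _ =>
      MvPolynomial.isHomogeneous_zero _ _ _⟩, by simp⟩⟩
    rw [matFun_zero]
    exact (hDivSubmodule Ω).zero_mem
  smul_mem' c τ hτ := by
    refine ⟨?_, fun K => ?_⟩
    · rw [matFun_smul]
      exact (hDivSubmodule Ω).smul_mem c hτ.1
    · obtain ⟨q, hq, hτq⟩ := hτ.2 K
      refine ⟨c • q, fun n => ⟨(hq n).1.smul c, fun i j =>
        (MvPolynomial.homogeneousSubmodule _ _ n).smul_mem c ((hq n).2 i j)⟩, ?_⟩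
      simp only [Pi.smul_apply, hτq, ← Finset.smul_sum]
      exact smul_comm _ _ _

/-- `Σ_{k,k',h}` as a subspace. -/
def stressSubmodule : Submodule ℝ (MatField T) :=
  sigmaTildeSubmodule k T ⊔ bubbleSubmodule k T ⊔ enrichSubmodule k k' T

variable {k k' T}

lemma mem_stressSubmodule {τ : MatField T} :
    τ ∈ stressSubmodule k k' T ↔ τ ∈ StressSpace k k' T := by
  simp only [stressSubmodule, Submodule.mem_sup]
  constructor <;> rintro ⟨_, ⟨a, ha, b, hb, rfl⟩, c, hc, rfl⟩ <;>
    exact ⟨_, ⟨a, ha, b, hb, rfl⟩, c, hc, rfl⟩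

lemma SigmaTilde.memHDiv {τ : MatField T} (h : τ ∈ SigmaTilde k T) : MemHDiv Ω (matFun T τ) := by
  refine memHDiv_of_memH1 (.of_forall fun x => Matrix.IsSymm.ext fun i j => ?_) h.1
  simp only [matFun_apply, (h.2 _).1.apply]

lemma StressSpace.memHDiv {τ : MatField T} (h : τ ∈ StressSpace k k' T) :
    MemHDiv Ω (matFun T τ) := by
  obtain ⟨_, ⟨a, ha, b, hb, rfl⟩, c, hc, rfl⟩ := h
  rw [matFun_add, matFun_add]
  exact (hDivSubmodule Ω).add_mem ((hDivSubmodule Ω).add_mem (SigmaTilde.memHDiv ha) hb.1) hc.1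

namespace Enrich
variable {τ : MatField T}

lemma exists_eq (h : τ ∈ Enrich k k' T) (K : T.cells) : ∃ q : Matrix (Fin 2) (Fin 2) Poly,
    q.IsSymm ∧ (∀ i j, (q i j).totalDegree ≤ k' - 3) ∧ τ K = K.1.bubble • q := by
  obtain ⟨q, hq, hτ⟩ := h.2 K
  refine ⟨_, Matrix.IsSymm.ext fun i j => ?_, fun i j => ?_, hτ⟩
  · simp only [Matrix.sum_apply, ((hq _).1).apply]
  · rw [Matrix.sum_apply]
    exact MvPolynomial.totalDegree_finsetSum_le fun n hn =>
      ((hq n).2 i j).totalDegree_le.trans (Finset.mem_Icc.1 hn).2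

lemma isSymm (h : τ ∈ Enrich k k' T) (K : T.cells) : (τ K).IsSymm := by
  obtain ⟨q, hq, -, hτ⟩ := exists_eq h K
  exact hτ ▸ hq.smul _

lemma normalZero (h : τ ∈ Enrich k k' T) (K : T.cells) : NormalZero K.1 (τ K) := by
  obtain ⟨q, -, -, hτ⟩ := exists_eq h K
  exact hτ ▸ NormalZero.bubble_smul _ _

end Enrich

lemma StressSpace.mem_Pkk {τ : MatField T} (h : τ ∈ StressSpace k k' T) (K : T.cells)
    (i j : Fin 2) : τ K i j ∈ Pkk k k' K.1 := by
  obtain ⟨_, ⟨a, ha, b, hb, rfl⟩, c, hc, rfl⟩ := h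
  obtain ⟨q, -, hq, hcq⟩ := Enrich.exists_eq hc K
  refine ⟨a K i j + b K i j, q i j, totalDegree_add_le ((ha.2 K).2 i j) ((hb.2 K).1.2 i j),
    hq i j, ?_⟩
  simp [hcq]

lemma Triangle.totalDegree_bubble (K : Triangle) : K.bubble.totalDegree ≤ 3 :=
  (MvPolynomial.totalDegree_mul _ _).trans <| add_le_add
    ((MvPolynomial.totalDegree_mul _ _).trans
      (add_le_add (K.totalDegree_bary 0) (K.totalDegree_bary 1))) (K.totalDegree_bary 2)

lemma totalDegree_le_of_mem_Pkk {K : Triangle} {p : Poly} (h : p ∈ Pkk k k' K) :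
    p.totalDegree ≤ k + k' + 3 := by
  obtain ⟨q, s, hq, hs, rfl⟩ := h
  have hbubble := K.totalDegree_bubble
  have hmul := MvPolynomial.totalDegree_mul K.bubble s
  exact totalDegree_add_le (by omega) (by omega)

/-! ### Finite dimension -/

lemma finite_of_totalDegree_le {V ι : Type*} [AddCommGroup V] [Module ℝ V] [Finite ι]
    (e : V →ₗ[ℝ] ι → Poly) (he : Function.Injective e) {m : ℕ} {S : Submodule ℝ V}
    (h : ∀ v ∈ S, ∀ i, (e v i).totalDegree ≤ m) : Module.Finite ℝ S := by
  let f : S →ₗ[ℝ] (ι → MvPolynomial.restrictTotalDegree (Fin 2) ℝ m) :=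
    LinearMap.pi fun i => (LinearMap.proj i ∘ₗ e ∘ₗ S.subtype).codRestrict _
      fun v => (MvPolynomial.mem_restrictTotalDegree _ _ _).2 (h v v.2 i)
  refine Module.Finite.of_injective f fun v w hvw => Subtype.ext (he (funext fun i => ?_))
  exact congrArg Subtype.val (congrFun hvw i)

instance finite_stressSubmodule : Module.Finite ℝ (stressSubmodule k k' T) := by
  let entries : MatField T →ₗ[ℝ] (T.cells × Fin 2 × Fin 2 → Poly) :=
    { toFun τ z := τ z.1 z.2.1 z.2.2
      map_add' _ _ := rfl
      map_smul' _ _ := rfl }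
  refine finite_of_totalDegree_le entries (fun σ τ h => ?_) fun τ hτ z =>
    totalDegree_le_of_mem_Pkk (StressSpace.mem_Pkk (mem_stressSubmodule.1 hτ) z.1 z.2.1 z.2.2)
  exact funext fun K => Matrix.ext fun i j => congrFun h (K, i, j)

variable (k k' T)

/-- The cellwise divergence as a linear map. -/
def pdivLin : MatField T →ₗ[ℝ] VecField T where
  toFun := pdiv T
  map_add' σ τ := by
    ext1 K; ext1 i
    simp [pdiv, Finset.sum_add_distrib]
  map_smul' c τ := by
    ext1 K; ext1 i
    simp only [pdiv, Pi.smul_apply, Matrix.smul_apply, Finset.smul_sum, RingHom.id_apply,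
      Derivation.map_smul]

@[simp] lemma pdivLin_apply (τ : MatField T) : pdivLin T τ = pdiv T τ := rfl

/-- The Hu-Zhang displacement space `V_{k,h}` as a subspace. -/
def vhzSubmodule : Submodule ℝ (VecField T) where
  carrier := VHZ k T
  add_mem' hv hw K i := totalDegree_add_le (hv K i) (hw K i)
  zero_mem' K i := by simp
  smul_mem' c _ hv K i := totalDegree_smul_le_of_le (hv K i) c

/-- `V_{k,k',h}` as a subspace. -/
def dispSubmodule : Submodule ℝ (VecField T) :=
  vhzSubmodule k T ⊔ (enrichSubmodule k k' T).map (pdivLin T)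

variable {k k' T}

lemma mem_dispSubmodule (hΩ : IsPolygonal Ω) {v : VecField T} :
    v ∈ dispSubmodule k k' T ↔ v ∈ DispSpace k k' T := by
  have hsum (w : VecField T) {τ : MatField T} (hτ : τ ∈ Enrich k k' T) :
      vecFun T w + weakDiv Ω (matFun T τ) =ᵐ[volume.restrict Ω] vecFun T (w + pdiv T τ) := by
    rw [vecFun_add]
    exact Filter.EventuallyEq.rfl.add (weakDiv_ae_eq hΩ T hτ.1)
  simp only [dispSubmodule, Submodule.mem_sup, Submodule.mem_map]
  constructor
  · rintro ⟨w, hw, _, ⟨τ, hτ, rfl⟩, rfl⟩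
    exact ⟨w, hw, τ, hτ, (hsum w hτ).symm⟩
  · rintro ⟨w, hw, τ, hτ, h⟩
    exact ⟨w, hw, _, ⟨τ, hτ, rfl⟩, (vecFun_injective hΩ T (h.trans (hsum w hτ))).symm⟩

instance finite_vhzSubmodule : Module.Finite ℝ (vhzSubmodule k T) := by
  let entries : VecField T →ₗ[ℝ] (T.cells × Fin 2 → Poly) :=
    { toFun v z := v z.1 z.2
      map_add' _ _ := rfl
      map_smul' _ _ := rfl }
  exact finite_of_totalDegree_le entries
    (fun v w h => funext fun K => funext fun i => congrFun h (K, i)) fun v hv z => hv z.1 z.2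

instance finite_dispSubmodule : Module.Finite ℝ (dispSubmodule k k' T) := by
  have henrich : Module.Finite ℝ (enrichSubmodule k k' T) :=
    Submodule.finiteDimensional_of_le (S₂ := stressSubmodule k k' T) le_sup_right
  unfold dispSubmodule
  infer_instance

/-! ### The `L²` product of piecewise polynomial vector fields -/

/-- Integration over `K` as a linear functional on polynomials. -/
def Triangle.integralLin (K : Triangle) : Poly →ₗ[ℝ] ℝ where
  toFun p := ∫ x in K.body, pval p x
  map_add' p q := by
    simp only [pval_add]
    exact integral_add (K.integrableOn_body (by fun_prop)) (K.integrableOn_body (by fun_prop))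
  map_smul' c p := by simp [integral_const_mul]

variable (T) in
/-- The `L²` product of piecewise polynomial vector fields. -/
def prodVec : VecField T →ₗ[ℝ] VecField T →ₗ[ℝ] ℝ :=
  LinearMap.mk₂ ℝ (fun v w => ∑ K : T.cells, K.1.integralLin (∑ i, v K i * w K i))
    (fun v v' w => by simp [add_mul, Finset.sum_add_distrib])
    (fun c v w => by simp [Finset.mul_sum, mul_add])
    (fun v w w' => by simp [mul_add, Finset.sum_add_distrib])
    (fun c v w => by simp [Finset.mul_sum, mul_add])

lemma prodVec_apply (v w : VecField T) :
    prodVec T v w = ∑ K : T.cells, ∫ x in K.1.body, pval (∑ i, v K i * w K i) x := rfl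

lemma prodVec_comm (v w : VecField T) : prodVec T v w = prodVec T w v := by
  simp only [prodVec_apply, mul_comm]

lemma eq_zero_of_sum_mul_self_eq_zero {ι : Type*} [Fintype ι] {v : ι → Poly}
    (h : ∑ i, v i * v i = 0) : v = 0 := by
  ext1 i
  refine MvPolynomial.funext fun y => ?_
  have hy : ∑ i, pval (v i) (WithLp.toLp 2 y) * pval (v i) (WithLp.toLp 2 y) = 0 := by
    simp only [← pval_mul, ← pval_sum, h, pval_zero]
  rw [Finset.sum_eq_zero_iff_of_nonneg fun i _ => mul_self_nonneg _] at hy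
  simpa [pval] using hy i (Finset.mem_univ i)

lemma eq_zero_of_prodVec_self {v : VecField T} (h : prodVec T v v = 0) : v = 0 := by
  have hpos (K : T.cells) (x : Plane) : 0 ≤ pval (∑ i, v K i * v K i) x := by
    simp only [pval_sum, pval_mul]
    exact Finset.sum_nonneg fun i _ => mul_self_nonneg _
  rw [prodVec_apply, Finset.sum_eq_zero_iff_of_nonneg fun K _ => integral_nonneg (hpos K)] at h
  exact funext fun K => eq_zero_of_sum_mul_self_eq_zero
    (K.1.integral_pval_eq_zero (fun x _ => hpos K x) (h K (Finset.mem_univ K)))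

lemma innerVec_vecFun (hΩ : IsPolygonal Ω) (v w : VecField T) :
    innerVec Ω (vecFun T v) (vecFun T w) = prodVec T v w :=
  T.integral_eq_sum hΩ (fun K => by fun_prop) fun K x hx => by
    simp only [vecFun_apply, scalFun_eq T _ K hx, pval_sum, pval_mul]

lemma innerVec_weakDiv (hΩ : IsPolygonal Ω) {τ : MatField T} (hτ : MemHDiv Ω (matFun T τ))
    (w : VecField T) :
    innerVec Ω (weakDiv Ω (matFun T τ)) (vecFun T w) = prodVec T (pdiv T τ) w := by
  rw [← innerVec_vecFun hΩ]
  refine integral_congr_ae ?_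
  filter_upwards [weakDiv_ae_eq hΩ T hτ] with x hx
  rw [hx]

lemma exists_orthogonal_projection {V : Type*} [AddCommGroup V] [Module ℝ V]
    {B : V →ₗ[ℝ] V →ₗ[ℝ] ℝ} (hB : ∀ v, B v v = 0 → v = 0)
    (M : Submodule ℝ V) [Module.Finite ℝ M] (v : V) : ∃ m ∈ M, ∀ m' ∈ M, B (v - m) m' = 0 := by
  have hinj : Function.Injective (B.domRestrict₁₂ M M) :=
    (injective_iff_map_eq_zero _).2 fun m hm => Subtype.ext (hB _ (DFunLike.congr_fun hm m))
  have hsurj := (LinearMap.injective_iff_surjective_of_finrank_eq_finrank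
    (Subspace.dual_finrank_eq (K := ℝ) (V := M)).symm).1 hinj
  obtain ⟨m, hm⟩ := hsurj ((B v).domRestrict M)
  refine ⟨m, m.2, fun m' hm' => ?_⟩
  rw [map_sub, LinearMap.sub_apply, sub_eq_zero]
  exact (DFunLike.congr_fun hm ⟨m', hm'⟩).symm

/-! ### Displacements orthogonal to the divergences of the stresses -/

section Rigid
variable {k k' : ℕ} {T : Triangulation Ω}

lemma prodVec_pdiv_single [DecidableEq T.cells] (K : T.cells)
    (τ : Matrix (Fin 2) (Fin 2) Poly) (w : VecField T) :
    prodVec T (pdiv T (Pi.single K τ)) w =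
      ∫ x in K.1.body, pval (∑ i, (∑ l, MvPolynomial.pderiv l (τ i l)) * w K i) x := by
  rw [prodVec_apply, Finset.sum_eq_single K]
  · simp only [pdiv, Pi.single_eq_same]
  · intro L _ hL
    simp [pdiv, Pi.single_eq_of_ne hL]
  · simp

lemma single_mem_bubbleSpace (hΩ : IsPolygonal Ω) [DecidableEq T.cells] (K : T.cells)
    {τ : Matrix (Fin 2) (Fin 2) Poly} (hτ : τ ∈ BubbleS k K.1) :
    Pi.single K τ ∈ BubbleSpace k T := by
  have hcell (L : T.cells) : (Pi.single K τ : MatField T) L ∈ BubbleS k L.1 := by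
    obtain rfl | hL := eq_or_ne L K
    · rwa [Pi.single_eq_same]
    · rw [Pi.single_eq_of_ne hL]
      exact (bubbleSSubmodule k L.1).zero_mem
  exact ⟨memHDiv_of_normalZero hΩ T (fun L => (hcell L).1.1)
    fun L => NormalZero.of_mem_bubbleS (hcell L), hcell⟩

lemma isRigid_of_orthogonal_bubbles (hΩ : IsPolygonal Ω) (hk : 2 ≤ k) {w : VecField T}
    (hw : w ∈ VHZ k T) (h : ∀ τ ∈ BubbleSpace k T, prodVec T (pdiv T τ) w = 0) (K : T.cells) :
    IsRigid (w K) := by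
  classical
  refine K.1.isRigid_of_edgeStrain fun j => K.1.edgeStrain_eq_zero j ?_
  rw [← prodVec_pdiv_single]
  exact h _ (single_mem_bubbleSpace hΩ K
    (K.1.edgeBubble_mem_bubbleS j hk ((totalDegree_gradForm_le (hw K) _ _).trans (by omega))))

lemma prodVec_pdiv_eq_zero {τ : MatField T} {r : VecField T} (hs : ∀ K, (τ K).IsSymm)
    (h : ∀ K, NormalZero K.1 (τ K)) (hr : ∀ K, IsRigid (r K)) : prodVec T (pdiv T τ) r = 0 := by
  rw [prodVec_apply]
  refine Finset.sum_eq_zero fun K _ => ?_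
  simp only [pdiv]
  rw [(h K).green_div, (hr K).sum_mul_pderiv (hs K)]
  simp

lemma prodVec_pdiv_bubble_add_enrich {β τ : MatField T} (hβ : β ∈ BubbleSpace k T)
    (hτ : τ ∈ Enrich k k' T) {r : VecField T} (hr : ∀ K, IsRigid (r K)) :
    prodVec T (pdiv T (β + τ)) r = 0 := by
  rw [← pdivLin_apply, map_add, map_add, LinearMap.add_apply, pdivLin_apply, pdivLin_apply,
    prodVec_pdiv_eq_zero (fun K => (hβ.2 K).1.1) (fun K => .of_mem_bubbleS (hβ.2 K)) hr,
    prodVec_pdiv_eq_zero (Enrich.isSymm hτ) (Enrich.normalZero hτ) hr, add_zero]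

/-- Project the `V_{k,h}` component on the divergences of the cell bubbles. -/
lemma exists_rigid_add_pdiv (hΩ : IsPolygonal Ω) (hk : 2 ≤ k) {u : VecField T}
    (hu : u ∈ DispSpace k k' T) : ∃ r : VecField T, (∀ K, IsRigid (r K)) ∧
      ∃ β ∈ BubbleSpace k T, ∃ τ ∈ Enrich k k' T, u = r + pdiv T (β + τ) := by
  obtain ⟨w, hw, _, ⟨τ, hτ, rfl⟩, rfl⟩ := Submodule.mem_sup.1 ((mem_dispSubmodule hΩ).2 hu)
  have hfin : Module.Finite ℝ (bubbleSubmodule k T) :=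
    Submodule.finiteDimensional_of_le (S₂ := stressSubmodule k k' T)
      (le_sup_right.trans le_sup_left)
  obtain ⟨_, ⟨β, hβ, rfl⟩, hproj⟩ := exists_orthogonal_projection
    (fun v => eq_zero_of_prodVec_self (v := v)) ((bubbleSubmodule k T).map (pdivLin T)) w
  have hdiv : pdivLin T β ∈ vhzSubmodule k T := fun K i =>
    MvPolynomial.totalDegree_finsetSum_le fun j _ =>
      (totalDegree_pderiv_le _ _).trans (Nat.sub_le_sub_right ((hβ.2 K).1.2 i j) 1)
  refine ⟨w - pdivLin T β, isRigid_of_orthogonal_bubbles hΩ hk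
    ((vhzSubmodule k T).sub_mem hw hdiv) fun σ hσ => ?_, β, hβ, τ, hτ, ?_⟩
  · rw [prodVec_comm]
    exact hproj _ ⟨σ, hσ, rfl⟩
  · rw [← pdivLin_apply, map_add]
    abel

lemma isRigid_of_orthogonal (hΩ : IsPolygonal Ω) (hk : 2 ≤ k) {u : VecField T}
    (hu : u ∈ DispSpace k k' T) (h : ∀ τ ∈ StressSpace k k' T, prodVec T (pdiv T τ) u = 0)
    (K : T.cells) : IsRigid (u K) := by
  obtain ⟨r, hr, β, hβ, τ, hτ, rfl⟩ := exists_rigid_add_pdiv hΩ hk hu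
  have hstress : β + τ ∈ StressSpace k k' T :=
    ⟨β, ⟨0, (sigmaTildeSubmodule k T).zero_mem, β, hβ, (zero_add β).symm⟩, τ, hτ, rfl⟩
  have hself := h _ hstress
  rw [map_add, prodVec_pdiv_bubble_add_enrich hβ hτ hr, zero_add] at hself
  rw [eq_zero_of_prodVec_self hself, add_zero]
  exact hr K

end Rigid

/-! ### Neighbouring cells -/

lemma eq_or_eq_add_one_or_eq_add_two (i j : Fin 3) : i = j ∨ i = j + 1 ∨ i = j + 2 := by
  revert i j
  decide

namespace Triangle

variable (K : Triangle)

lemma sum_bary_rotate (j : Fin 3) (x : Plane) :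
    pval (K.bary j) x + pval (K.bary (j + 1)) x + pval (K.bary (j + 2)) x = 1 := by
  have hsum := K.sum_bary x
  rw [Fin.sum_univ_three] at hsum
  fin_cases j <;> simp <;> linarith

lemma mem_openSegment_iff (j : Fin 3) (x : Plane) :
    x ∈ openSegment ℝ (K.points (j + 1)) (K.points (j + 2)) ↔
      pval (K.bary j) x = 0 ∧ 0 < pval (K.bary (j + 1)) x ∧ 0 < pval (K.bary (j + 2)) x := by
  constructor
  · rw [openSegment_eq_image_lineMap]
    rintro ⟨t, ⟨ht0, ht1⟩, rfl⟩
    simp [K.bary_lineMap, K.bary_points, AffineMap.lineMap_apply_ring, ht0, ht1]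
  · rintro ⟨h0, h1, h2⟩
    have hsum := K.sum_bary_rotate j x
    refine ⟨_, _, h1, h2, by linarith, ?_⟩
    conv_rhs => rw [← K.pointOf_bary x, pointOf, Fin.sum_univ_three]
    fin_cases j <;> simp_all [add_comm]

lemma openSegment_subset_body (j : Fin 3) :
    openSegment ℝ (K.points (j + 1)) (K.points (j + 2)) ⊆ K.body :=
  (openSegment_subset_segment ℝ _ _).trans (K.segment_subset_body _ _)

lemma abs_det_mul_bary (j : Fin 3) {x : Plane} (hx : pval (K.bary j) x = 0) (y : Plane) :
    |K.det| * pval (K.bary j) y = ∑ i, K.inwardNormal j i * (y i - x i) := by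
  have hy : pval (K.bary j) y = pval (K.bary j) y - pval (K.bary j) x := by rw [hx, sub_zero]
  rw [hy]
  simp only [pval_bary, inwardNormal, Fin.sum_univ_two]
  ring

variable {K} in
lemma inwardNormal_eq_or_eq_neg {L : Triangle} {j l : Fin 3}
    (h : s(L.points (l + 1), L.points (l + 2)) = s(K.points (j + 1), K.points (j + 2))) :
    (∀ i, L.inwardNormal l i = K.inwardNormal j i) ∨
      ∀ i, L.inwardNormal l i = -K.inwardNormal j i := by
  have hK := K.det_ne_zero
  have hL := L.det_ne_zero
  simp only [inwardNormal, baryGrad, Fin.forall_fin_two, Pi.smul_apply, smul_eq_mul,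
    Matrix.cons_val_zero, Matrix.cons_val_one]
  rcases Sym2.eq_iff.1 h with ⟨h1, h2⟩ | ⟨h1, h2⟩ <;> rw [h1, h2] <;>
    rcases abs_choice K.det with hK' | hK' <;> rcases abs_choice L.det with hL' | hL' <;>
    rw [hK', hL'] <;> field_simp <;> simp

end Triangle

/-- The edge of `K` opposite to the vertex `j` is the edge of `L` opposite to the vertex `l`, and
the two triangles lie on different sides of it. -/
structure IsOpposite (K L : Triangle) (j l : Fin 3) : Prop where
  points : s(L.points (l + 1), L.points (l + 2)) = s(K.points (j + 1), K.points (j + 2))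
  inwardNormal : ∀ i, L.inwardNormal l i = -K.inwardNormal j i

namespace IsOpposite

variable {K L : Triangle} {j l : Fin 3}

lemma bary_points_eq_zero
    (h : s(L.points (l + 1), L.points (l + 2)) = s(K.points (j + 1), K.points (j + 2))) :
    pval (L.bary l) (K.points (j + 1)) = 0 := by
  have hmem : K.points (j + 1) ∈ s(L.points (l + 1), L.points (l + 2)) := h ▸ Sym2.mem_mk_left _ _
  rcases Sym2.mem_iff.1 hmem with h | h <;> simp [h, L.bary_points]

/-- Otherwise the two barycentric coordinates would have the same sign at `y`. -/
lemma of_bary_neg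
    (h : s(L.points (l + 1), L.points (l + 2)) = s(K.points (j + 1), K.points (j + 2)))
    {y : Plane} (hK : pval (K.bary j) y < 0) (hL : 0 ≤ pval (L.bary l) y) :
    IsOpposite K L j l := by
  refine ⟨h, (Triangle.inwardNormal_eq_or_eq_neg h).resolve_left fun heq => ?_⟩
  have hKy := K.abs_det_mul_bary j (x := K.points (j + 1)) (by simp [K.bary_points]) y
  have hLy := L.abs_det_mul_bary l (bary_points_eq_zero h) y
  simp only [heq, ← hKy] at hLy
  have := mul_neg_of_pos_of_neg K.abs_det_pos hK
  have := mul_nonneg L.abs_det_pos.le hL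
  linarith

lemma abs_det_mul_bary (h : IsOpposite K L j l) (y : Plane) :
    |L.det| * pval (L.bary l) y = -(|K.det| * pval (K.bary j) y) := by
  rw [K.abs_det_mul_bary j (x := K.points (j + 1)) (by simp [K.bary_points]),
    L.abs_det_mul_bary l (bary_points_eq_zero h.points)]
  simp only [h.inwardNormal, neg_mul, Finset.sum_neg_distrib]

lemma openSegment_eq (h : IsOpposite K L j l) :
    openSegment ℝ (L.points (l + 1)) (L.points (l + 2)) =
      openSegment ℝ (K.points (j + 1)) (K.points (j + 2)) := by
  rcases Sym2.eq_iff.1 h.points with ⟨h1, h2⟩ | ⟨h1, h2⟩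
  · rw [h1, h2]
  · rw [h1, h2, openSegment_symm]

end IsOpposite

namespace Triangulation

variable (T : Triangulation Ω)

lemma eventually_mem_body_of_mem_body (x : Plane) :
    ∀ᶠ y in nhds x, ∀ L : T.cells, y ∈ L.1.body → x ∈ L.1.body := by
  rw [Filter.eventually_all]
  intro L
  by_cases hx : x ∈ L.1.body
  · exact .of_forall fun _ _ => hx
  · filter_upwards [L.1.isCompact_body.isClosed.isOpen_compl.mem_nhds hx] with y hy hyL
    exact absurd hyL hy

lemma exists_edge_eq {K L : T.cells} (hLK : L ≠ K) {j : Fin 3} {x : Plane}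
    (hx : x ∈ openSegment ℝ (K.1.points (j + 1)) (K.1.points (j + 2))) (hxL : x ∈ L.1.body) :
    ∃ l, s(L.1.points (l + 1), L.1.points (l + 2)) =
      s(K.1.points (j + 1), K.1.points (j + 2)) := by
  have hxKL : x ∈ K.1.body ∩ L.1.body := ⟨K.1.openSegment_subset_body j hx, hxL⟩
  obtain ⟨-, hx1, hx2⟩ := (K.1.mem_openSegment_iff j x).1 hx
  rcases T.conforming K.1 K.2 L.1 L.2 (Subtype.coe_injective.ne hLK.symm) with
    h | ⟨i, -, -, h⟩ | ⟨i, i', m, m', hii', hi, hi', h⟩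
  · simp [h] at hxKL
  · rw [h, mem_singleton_iff] at hxKL
    rw [hxKL, K.1.bary_points] at hx1 hx2
    have hij : j + 1 = i ∧ j + 2 = i := by constructor <;> by_contra hne <;> simp [hne] at hx1 hx2
    exact absurd (hij.1.trans hij.2.symm) (by simp)
  · rw [h] at hxKL
    have hedge : s(i, i') = s(j + 1, j + 2) := by
      have hi1 : ¬(i ≠ j + 1 ∧ i' ≠ j + 1) := fun hne =>
        hx1.ne' (K.1.bary_eq_zero_of_mem_segment hne.1 hne.2 hxKL)
      have hi2 : ¬(i ≠ j + 2 ∧ i' ≠ j + 2) := fun hne =>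
        hx2.ne' (K.1.bary_eq_zero_of_mem_segment hne.1 hne.2 hxKL)
      clear * - hi1 hi2
      revert i i' j
      decide
    have hmm' : m ≠ m' := fun hm => hii' (K.1.independent.injective (by rw [hi, hi', hm]))
    obtain ⟨l, hl⟩ : ∃ l : Fin 3, s(l + 1, l + 2) = s(m, m') := by
      clear * - hmm'
      revert m m'
      decide
    have hpoints := congrArg (Sym2.map K.1.points) hedge
    rw [Sym2.map_mk, hi, hi', ← Sym2.map_mk, ← hl] at hpoints
    exact ⟨l, hpoints⟩

lemma exists_mem_body_bary_neg (hΩ : IsPolygonal Ω) (K : Triangle) {j : Fin 3} {x : Plane}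
    (hx : x ∈ Ω) (hbary : pval (K.bary j) x = 0) :
    ∃ L : T.cells, x ∈ L.1.body ∧ ∃ y ∈ L.1.body, pval (K.bary j) y < 0 := by
  have hline : Filter.Tendsto (fun s : ℝ => (AffineMap.lineMap x (K.points j) s : Plane))
      (nhdsWithin 0 (Iio 0)) (nhds x) := by
    simpa using (AffineMap.lineMap_continuous (R := ℝ) (p := x) (q := K.points j)).continuousAt
      (x := (0 : ℝ)) |>.mono_left nhdsWithin_le_nhds
  obtain ⟨s, ⟨hcell, hyΩ⟩, hs⟩ := ((hline.eventually
    ((T.eventually_mem_body_of_mem_body x).and (hΩ.isOpen.mem_nhds hx))).and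
      self_mem_nhdsWithin).exists
  obtain ⟨L, hyL⟩ := T.exists_mem_body (subset_closure hyΩ)
  refine ⟨L, hcell L hyL, _, hyL, ?_⟩
  rw [K.bary_lineMap, hbary, K.bary_points]
  simpa [AffineMap.lineMap_apply] using hs

lemma exists_isOpposite (hΩ : IsPolygonal Ω) (K : T.cells) {j : Fin 3} {x : Plane}
    (hx : x ∈ openSegment ℝ (K.1.points (j + 1)) (K.1.points (j + 2))) (hxΩ : x ∈ Ω) :
    ∃ L : T.cells, L ≠ K ∧ ∃ l, IsOpposite K.1 L.1 j l := by
  obtain ⟨L, hxL, y, hyL, hyK⟩ :=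
    T.exists_mem_body_bary_neg hΩ K.1 hxΩ ((K.1.mem_openSegment_iff j x).1 hx).1
  rw [L.1.body_eq] at hyL
  have hLK : L ≠ K := by
    rintro rfl
    exact (hyL j).not_gt hyK
  obtain ⟨l, hl⟩ := T.exists_edge_eq hLK hx hxL
  exact ⟨L, hLK, l, .of_bary_neg hl hyK (hyL l)⟩

end Triangulation

/-! ### Rigid motions have no jumps -/

/-- The mean over the segment from `a` to `b`, weighted with the quadratic bubble of the segment. -/
def bubbleMean (a b : Plane) (G : Plane → ℝ) : ℝ :=
  ∫ t in (0 : ℝ)..1, t * (1 - t) * G (AffineMap.lineMap a b t)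

section BubbleMean

variable (a b : Plane) {F G : Plane → ℝ}

lemma bubbleMean_comm (G : Plane → ℝ) : bubbleMean a b G = bubbleMean b a G := by
  have h := intervalIntegral.integral_comp_sub_left (a := 0) (b := 1)
    (fun t => t * (1 - t) * G (AffineMap.lineMap b a t)) 1
  simp only [AffineMap.lineMap_apply_one_sub, sub_sub_cancel, sub_self, sub_zero] at h
  simp only [bubbleMean, ← h, mul_comm (1 - _ : ℝ)]

variable {a b}

lemma bubbleMean_eq_zero (h : ∀ x ∈ openSegment ℝ a b, G x = 0) : bubbleMean a b G = 0 := by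
  rw [bubbleMean, intervalIntegral.integral_of_le zero_le_one, integral_Ioc_eq_integral_Ioo]
  refine setIntegral_eq_zero_of_forall_eq_zero fun t ht => ?_
  rw [h, mul_zero]
  rw [openSegment_eq_image_lineMap]
  exact mem_image_of_mem _ ht

lemma bubbleMean_add (hF : Continuous F) (hG : Continuous G) :
    bubbleMean a b (fun x => F x + G x) = bubbleMean a b F + bubbleMean a b G := by
  unfold bubbleMean
  rw [← intervalIntegral.integral_add (Continuous.intervalIntegrable (by fun_prop) _ _)
    (Continuous.intervalIntegrable (by fun_prop) _ _)]
  simp only [mul_add]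

lemma eq_zero_of_bubbleMean_eq_zero (hG : Continuous G) (hn : ∀ x, 0 ≤ G x)
    (h : bubbleMean a b G = 0) {x : Plane} (hx : x ∈ openSegment ℝ a b) : G x = 0 := by
  rw [openSegment_eq_image_lineMap] at hx
  obtain ⟨t, ht, rfl⟩ := hx
  have hcont : Continuous fun t : ℝ => t * (1 - t) * G (AffineMap.lineMap a b t) := by fun_prop
  have hnonneg (s : ℝ) (hs : s ∈ Ioo (0 : ℝ) 1) :
      0 ≤ s * (1 - s) * G (AffineMap.lineMap a b s) :=
    mul_nonneg (mul_nonneg hs.1.le (sub_nonneg.2 hs.2.le)) (hn _)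
  rw [bubbleMean, intervalIntegral.integral_of_le zero_le_one, integral_Ioc_eq_integral_Ioo,
    setIntegral_eq_zero_iff_of_nonneg_ae
      ((ae_restrict_iff' measurableSet_Ioo).2 (.of_forall hnonneg))
      (hcont.integrableOn_Icc.mono_set Ioo_subset_Icc_self)] at h
  have hzero := Measure.eqOn_open_of_ae_eq h isOpen_Ioo hcont.continuousOn continuousOn_const ht
  exact (mul_eq_zero.1 hzero).resolve_left (mul_pos ht.1 (sub_pos.2 ht.2)).ne'

end BubbleMean

/-- The symmetric matrix field `d nᵀ + n dᵀ`. -/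
def symmProd (n : Fin 2 → ℝ) (d : Fin 2 → Poly) : Matrix (Fin 2) (Fin 2) Poly :=
  Matrix.of fun a b => n b • d a + n a • d b

lemma symmProd_mem_polyS (n : Fin 2 → ℝ) {d : Fin 2 → Poly} {m : ℕ}
    (h : ∀ i, (d i).totalDegree ≤ m) : symmProd n d ∈ PolyS m :=
  ⟨Matrix.IsSymm.ext fun a b => by simp only [symmProd, Matrix.of_apply, add_comm],
    fun a b => totalDegree_add_le (totalDegree_smul_le_of_le (h a) _)
      (totalDegree_smul_le_of_le (h b) _)⟩

lemma sum_symmProd_mul_self (n : Fin 2 → ℝ) (d : Fin 2 → Poly) (x : Plane) :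
    ∑ i, (∑ l, n l * pval (symmProd n d i l) x) * pval (d i) x =
      (∑ l, n l ^ 2) * ∑ i, pval (d i) x ^ 2 + (∑ i, n i * pval (d i) x) ^ 2 := by
  simp only [symmProd, Matrix.of_apply, pval_add, pval_smul, Fin.sum_univ_two]
  ring

lemma sum_symmProd_mul_self_nonneg (n : Fin 2 → ℝ) (d : Fin 2 → Poly) (x : Plane) :
    0 ≤ ∑ i, (∑ l, n l * pval (symmProd n d i l) x) * pval (d i) x := by
  rw [sum_symmProd_mul_self]
  positivity

lemma eq_zero_of_sum_symmProd_mul_self {n : Fin 2 → ℝ} (hn : n ≠ 0) {d : Fin 2 → Poly} {x : Plane}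
    (h : ∑ i, (∑ l, n l * pval (symmProd n d i l) x) * pval (d i) x = 0) (i : Fin 2) :
    pval (d i) x = 0 := by
  have hpos : 0 < ∑ l, n l ^ 2 := by
    obtain ⟨l, hl⟩ := Function.ne_iff.1 hn
    exact Finset.sum_pos' (fun _ _ => sq_nonneg _) ⟨l, Finset.mem_univ l, sq_pos_of_ne_zero hl⟩
  rw [sum_symmProd_mul_self, add_eq_zero_iff_of_nonneg (by positivity) (sq_nonneg _),
    mul_eq_zero_iff_left hpos.ne', Finset.sum_eq_zero_iff_of_nonneg fun i _ => sq_nonneg _] at h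
  exact pow_eq_zero_iff two_ne_zero |>.1 (h.1 i (Finset.mem_univ i))

namespace Triangle

variable (K : Triangle)

/-- On the edges other than the one opposite to `j` the weight vanishes. -/
lemma sum_edgeMean_bary_mul_bary (j : Fin 3) (c : Fin 3 → ℝ) (G : Fin 3 → Plane → ℝ) :
    ∑ i, c i * K.edgeMean i (fun x => pval (K.bary (j + 1) * K.bary (j + 2)) x * G i x) =
      c j * bubbleMean (K.points (j + 1)) (K.points (j + 2)) (G j) := by
  rw [Finset.sum_eq_single j]
  · congr 1
    simp [edgeMean, segmentMean, bubbleMean, K.bary_lineMap, K.bary_points,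
      AffineMap.lineMap_apply_ring, mul_comm]
  · intro i _ hij
    rw [K.edgeMean_eq_zero, mul_zero]
    intro x hx
    have hzero := ((K.mem_openSegment_iff i x).1 hx).1
    rcases eq_or_eq_add_one_or_eq_add_two i j with rfl | rfl | rfl
    · exact absurd rfl hij
    · simp [hzero]
    · simp [hzero]
  · simp

/-- The matrix field `λ_p λ_q Q` that belongs to the edge `[p, q]` opposite to the vertex `j`. -/
def edgeField (j : Fin 3) (Q : Matrix (Fin 2) (Fin 2) Poly) : Matrix (Fin 2) (Fin 2) Poly :=
  (K.bary (j + 1) * K.bary (j + 2)) • Q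

lemma edgeField_mem_polyS (j : Fin 3) {k : ℕ} (hk : 3 ≤ k) {Q : Matrix (Fin 2) (Fin 2) Poly}
    (hQ : Q ∈ PolyS 1) : K.edgeField j Q ∈ PolyS k :=
  ⟨hQ.1.smul _, fun a b => K.totalDegree_bary_mul_le _ _ (by omega) ((hQ.2 a b).trans (by omega))⟩

lemma integral_pderiv_edgeField (j : Fin 3) (Q : Matrix (Fin 2) (Fin 2) Poly) {φ : Plane → ℝ}
    (hφ : ContDiff ℝ 1 φ) (a b i : Fin 2) :
    ∫ x in K.body, pderiv i (fun x => pval (K.edgeField j Q a b) x * φ x) x =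
      -(K.inwardNormal j i * bubbleMean (K.points (j + 1)) (K.points (j + 2))
        fun x => pval (Q a b) x * φ x) := by
  rw [K.green (contDiff_pval_mul _ hφ),
    ← K.sum_edgeMean_bary_mul_bary j (fun m => K.inwardNormal m i) fun _ x => pval (Q a b) x * φ x]
  simp only [edgeField, Matrix.smul_apply, smul_eq_mul, pval_mul, mul_assoc]

lemma integral_div_edgeField (j : Fin 3) {Q : Matrix (Fin 2) (Fin 2) Poly} (hQ : Q.IsSymm)
    {w : Fin 2 → Poly} (hw : IsRigid w) :
    ∫ x in K.body, pval (∑ i, (∑ l, MvPolynomial.pderiv l (K.edgeField j Q i l)) * w i) x =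
      -bubbleMean (K.points (j + 1)) (K.points (j + 2))
        fun x => ∑ i, (∑ l, K.inwardNormal j l * pval (Q i l) x) * pval (w i) x := by
  have hs : (K.edgeField j Q).IsSymm := hQ.smul _
  have hedge := K.sum_edgeMean_bary_mul_bary j (fun _ => 1)
    fun m x => ∑ i, (∑ l, K.inwardNormal m l * pval (Q i l) x) * pval (w i) x
  simp only [one_mul] at hedge
  rw [K.green_div, hw.sum_mul_pderiv hs, ← hedge]
  simp only [pval_zero, integral_zero, sub_zero, edgeField, Matrix.smul_apply, smul_eq_mul,
    pval_mul, Finset.mul_sum, Finset.sum_mul]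
  refine congrArg _ (Finset.sum_congr rfl fun m _ => congrArg _ (funext fun x => ?_))
  refine Finset.sum_congr rfl fun a _ => Finset.sum_congr rfl fun b _ => ?_
  ring

end Triangle

section EdgeJumps

variable {k : ℕ} {T : Triangulation Ω} [DecidableEq T.cells] {K L : T.cells} {j l : Fin 3}
  {Q : Matrix (Fin 2) (Fin 2) Poly}

lemma IsOpposite.bubbleMean_eq {K L : Triangle} (h : IsOpposite K L j l) (G : Plane → ℝ) :
    bubbleMean (L.points (l + 1)) (L.points (l + 2)) G =
      bubbleMean (K.points (j + 1)) (K.points (j + 2)) G := by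
  rcases Sym2.eq_iff.1 h.points with ⟨h1, h2⟩ | ⟨h1, h2⟩
  · rw [h1, h2]
  · rw [h1, h2, bubbleMean_comm]

lemma single_edgeField_apply_mem_polyS (hk : 3 ≤ k) (hQ : Q ∈ PolyS 1) (M : T.cells) :
    (Pi.single K (K.1.edgeField j Q) : MatField T) M ∈ PolyS k := by
  obtain rfl | hM := eq_or_ne M K
  · rw [Pi.single_eq_same]
    exact M.1.edgeField_mem_polyS j hk hQ
  · rw [Pi.single_eq_of_ne hM]
    exact (polySSubmodule k).zero_mem

lemma single_edgeField_mem_sigmaTilde (hΩ : IsPolygonal Ω) (hk : 3 ≤ k)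
    (hb : ∀ x ∈ openSegment ℝ (K.1.points (j + 1)) (K.1.points (j + 2)), x ∉ Ω)
    (hQ : Q ∈ PolyS 1) : Pi.single K (K.1.edgeField j Q) ∈ SigmaTilde k T := by
  refine ⟨fun a b => ?_, single_edgeField_apply_mem_polyS hk hQ⟩
  simp only [matFun_apply]
  refine memH1_of_forall hΩ T _ fun φ hφ i => ?_
  rw [Finset.sum_eq_single K]
  · simp only [Pi.single_eq_same]
    rw [K.1.integral_pderiv_edgeField j Q hφ.contDiff_one, bubbleMean_eq_zero, mul_zero, neg_zero]
    intro x hx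
    rw [hφ.eq_zero (hb x hx), mul_zero]
  · intro L _ hL
    simp [Pi.single_eq_of_ne hL, pderiv]
  · simp

lemma single_add_single_edgeField_mem_sigmaTilde (hΩ : IsPolygonal Ω) (hk : 3 ≤ k) (hne : L ≠ K)
    (ho : IsOpposite K.1 L.1 j l) (hQ : Q ∈ PolyS 1) :
    Pi.single K (K.1.edgeField j Q) + Pi.single L (L.1.edgeField l Q) ∈ SigmaTilde k T := by
  refine ⟨fun a b => ?_, fun M => (polySSubmodule k).add_mem
    (single_edgeField_apply_mem_polyS hk hQ M) (single_edgeField_apply_mem_polyS hk hQ M)⟩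
  simp only [matFun_apply]
  refine memH1_of_forall hΩ T _ fun φ hφ i => ?_
  rw [Finset.sum_eq_add K L hne.symm]
  · simp only [Pi.add_apply, Pi.single_eq_same, Pi.single_eq_of_ne hne, Pi.single_eq_of_ne hne.symm,
      add_zero, zero_add]
    rw [K.1.integral_pderiv_edgeField j Q hφ.contDiff_one,
      L.1.integral_pderiv_edgeField l Q hφ.contDiff_one, ho.bubbleMean_eq, ho.inwardNormal]
    ring
  · intro M _ hM
    simp [Pi.single_eq_of_ne hM.1, Pi.single_eq_of_ne hM.2, pderiv]
  · simp
  · simp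

end EdgeJumps

section NoJumps

variable {k : ℕ} {T : Triangulation Ω} {u : VecField T} {K L : T.cells} {j l : Fin 3}

lemma eq_zero_of_boundary_edge (hΩ : IsPolygonal Ω) (hk : 3 ≤ k) (hu : ∀ K, IsRigid (u K))
    (h : ∀ τ ∈ SigmaTilde k T, prodVec T (pdiv T τ) u = 0)
    (hb : ∀ x ∈ openSegment ℝ (K.1.points (j + 1)) (K.1.points (j + 2)), x ∉ Ω)
    {x : Plane} (hx : x ∈ openSegment ℝ (K.1.points (j + 1)) (K.1.points (j + 2))) (i : Fin 2) :
    pval (u K i) x = 0 := by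
  classical
  have hQ := symmProd_mem_polyS (K.1.inwardNormal j) (hu K).totalDegree_le
  have horth := h _ (single_edgeField_mem_sigmaTilde hΩ hk hb hQ)
  rw [prodVec_pdiv_single, K.1.integral_div_edgeField j hQ.1 (hu K), neg_eq_zero] at horth
  exact eq_zero_of_sum_symmProd_mul_self (K.1.inwardNormal_ne_zero j)
    (eq_zero_of_bubbleMean_eq_zero (by fun_prop) (sum_symmProd_mul_self_nonneg _ _) horth hx) i

lemma eq_of_interior_edge (hΩ : IsPolygonal Ω) (hk : 3 ≤ k) (hu : ∀ K, IsRigid (u K))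
    (h : ∀ τ ∈ SigmaTilde k T, prodVec T (pdiv T τ) u = 0) (hne : L ≠ K)
    (ho : IsOpposite K.1 L.1 j l)
    {x : Plane} (hx : x ∈ openSegment ℝ (K.1.points (j + 1)) (K.1.points (j + 2))) (i : Fin 2) :
    pval (u K i) x = pval (u L i) x := by
  classical
  set n := K.1.inwardNormal j
  have hd : IsRigid (u K - u L) := (hu K).sub (hu L)
  have hQ := symmProd_mem_polyS n hd.totalDegree_le
  set Q := symmProd n (u K - u L)
  have horth := h _ (single_add_single_edgeField_mem_sigmaTilde hΩ hk hne ho hQ)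
  rw [← pdivLin_apply, map_add, map_add, LinearMap.add_apply, pdivLin_apply, pdivLin_apply,
    prodVec_pdiv_single, prodVec_pdiv_single, K.1.integral_div_edgeField j hQ.1 (hu K),
    L.1.integral_div_edgeField l hQ.1 (hu L), ho.bubbleMean_eq,
    ← neg_add, neg_eq_zero, ← bubbleMean_add (by fun_prop) (by fun_prop)] at horth
  have hmean : bubbleMean (K.1.points (j + 1)) (K.1.points (j + 2))
      (fun x => ∑ i, (∑ l, n l * pval (Q i l) x) * pval ((u K - u L) i) x) = 0 := by
    rw [← horth]
    congr! 2 with x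
    simp only [Pi.sub_apply, pval_sub, ho.inwardNormal, Fin.sum_univ_two]
    ring
  have hzero := eq_zero_of_sum_symmProd_mul_self (K.1.inwardNormal_ne_zero j)
    (eq_zero_of_bubbleMean_eq_zero (by fun_prop) (sum_symmProd_mul_self_nonneg _ _) hmean hx) i
  rwa [Pi.sub_apply, pval_sub, sub_eq_zero] at hzero

end NoJumps

/-! ### Surjectivity of the discrete divergence -/

/-- The complement of a countable set is connected, so it cannot be split by the frontier of `s`. -/
lemma exists_mem_frontier_notMem {E : Type*} [AddCommGroup E] [Module ℝ E] [TopologicalSpace E]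
    [ContinuousAdd E] [ContinuousSMul ℝ E] (hE : 1 < Module.rank ℝ E) {s t : Set E}
    (ht : t.Countable) (hs : (interior s).Nonempty) (hs' : (interior sᶜ).Nonempty) :
    ∃ x ∈ frontier s, x ∉ t := by
  have : Nontrivial E := (rank_pos_iff_nontrivial (R := ℝ)).1 (zero_lt_one.trans hE)
  have hdense := ht.dense_compl ℝ
  by_contra! hfrontier
  have hcover : tᶜ ⊆ interior s ∪ interior sᶜ := fun x hx => by
    rw [← compl_frontier_eq_union_interior]
    exact fun hxs => hx (hfrontier x hxs)
  obtain ⟨x, -, hx, hx'⟩ := (ht.isPathConnected_compl_of_one_lt_rank hE).isConnected.isPreconnected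
    _ _ isOpen_interior isOpen_interior hcover
    (inter_comm _ _ ▸ hdense.inter_open_nonempty _ isOpen_interior hs)
    (inter_comm _ _ ▸ hdense.inter_open_nonempty _ isOpen_interior hs')
  exact interior_subset hx' (interior_subset hx)

lemma one_lt_rank_plane : 1 < Module.rank ℝ Plane := by
  simp [← Module.finrank_eq_rank]

namespace Triangle

variable (K : Triangle)

lemma points_ne (j : Fin 3) : K.points (j + 1) ≠ K.points (j + 2) :=
  K.independent.injective.ne (by simp)

variable {K} in
lemma eq_points_of_bary_eq_zero {x : Plane} {j : Fin 3} (h : ∀ i ≠ j, pval (K.bary i) x = 0) :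
    x = K.points j := by
  have hsum := K.sum_bary x
  have hpoint := K.pointOf_bary x
  rw [Finset.sum_eq_single j (fun i _ => h i) (by simp)] at hsum
  rw [pointOf, Finset.sum_eq_single j (fun i _ hi => by rw [h i hi, zero_smul]) (by simp), hsum,
    one_smul] at hpoint
  exact hpoint.symm

lemma exists_mem_openSegment_of_mem_frontier {x : Plane} (hx : x ∈ frontier K.body)
    (hvertex : ∀ i, x ≠ K.points i) :
    ∃ j, x ∈ openSegment ℝ (K.points (j + 1)) (K.points (j + 2)) := by
  rw [K.isCompact_body.isClosed.frontier_eq, K.interior_body, K.body_eq] at hx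
  obtain ⟨hnonneg, hx⟩ := hx
  obtain ⟨j, hj⟩ := not_forall.1 hx
  have hj := le_antisymm (not_lt.1 hj) (hnonneg j)
  refine ⟨j, (K.mem_openSegment_iff j x).2
    ⟨hj, (hnonneg _).lt_of_ne' fun h1 => hvertex (j + 2) (eq_points_of_bary_eq_zero fun i hi => ?_),
      (hnonneg _).lt_of_ne' fun h2 => hvertex (j + 1) (eq_points_of_bary_eq_zero fun i hi => ?_)⟩⟩
  · rcases eq_or_eq_add_one_or_eq_add_two i j with rfl | rfl | rfl
    exacts [hj, h1, absurd rfl hi]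
  · rcases eq_or_eq_add_one_or_eq_add_two i j with rfl | rfl | rfl
    exacts [hj, absurd rfl hi, h2]

end Triangle

lemma IsOpposite.union_body_mem_nhds {K L : Triangle} {j l : Fin 3} (h : IsOpposite K L j l)
    {x : Plane} (hx : x ∈ openSegment ℝ (K.points (j + 1)) (K.points (j + 2))) :
    K.body ∪ L.body ∈ nhds x := by
  obtain ⟨-, hK1, hK2⟩ := (K.mem_openSegment_iff j x).1 hx
  obtain ⟨-, hL1, hL2⟩ := (L.mem_openSegment_iff l x).1 (h.openSegment_eq ▸ hx)
  have hpos {p : Poly} (hp : 0 < pval p x) : ∀ᶠ y in nhds x, 0 < pval p y :=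
    (continuous_pval p).continuousAt.eventually (lt_mem_nhds hp)
  filter_upwards [hpos hK1, hpos hK2, hpos hL1, hpos hL2] with y hK1 hK2 hL1 hL2
  simp only [mem_union, Triangle.body_eq, mem_ofPred_eq]
  rcases le_total 0 (pval (K.bary j) y) with hy | hy
  · left
    intro i
    rcases eq_or_eq_add_one_or_eq_add_two i j with rfl | rfl | rfl
    exacts [hy, hK1.le, hK2.le]
  · right
    intro i
    rcases eq_or_eq_add_one_or_eq_add_two i l with rfl | rfl | rfl
    · refine nonneg_of_mul_nonneg_right ?_ L.abs_det_pos
      rw [h.abs_det_mul_bary]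
      exact neg_nonneg.2 (mul_nonpos_of_nonneg_of_nonpos K.abs_det_pos.le hy)
    · exact hL1.le
    · exact hL2.le

lemma IsRigid.eq_zero_of_openSegment {w : Fin 2 → Poly} (h : IsRigid w) {a b : Plane} (hab : a ≠ b)
    (h0 : ∀ x ∈ openSegment ℝ a b, ∀ i, pval (w i) x = 0) : w = 0 := by
  have hmem (t : ℝ) (ht : t ∈ Ioo 0 1) : AffineMap.lineMap a b t ∈ openSegment ℝ a b :=
    openSegment_eq_image_lineMap ℝ a b ▸ mem_image_of_mem _ ht
  exact h.eq_zero ((AffineMap.lineMap_injective ℝ hab).ne (a₁ := 1 / 3) (a₂ := 2 / 3) (by norm_num))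
    (h0 _ (hmem _ (by norm_num))) (h0 _ (hmem _ (by norm_num)))

lemma Triangulation.exists_edge_mem_frontier (T : Triangulation Ω) {N : Set T.cells}
    (hN : N.Nonempty) : ∃ K ∈ N, ∃ j, ∃ x ∈ openSegment ℝ (K.1.points (j + 1)) (K.1.points (j + 2)),
      x ∈ frontier (⋃ L ∈ N, L.1.body) := by
  have hcompact : IsCompact (⋃ L ∈ N, L.1.body) :=
    N.toFinite.isCompact_biUnion fun L _ => L.1.isCompact_body
  have hinterior : (interior (⋃ L ∈ N, L.1.body)).Nonempty := by
    obtain ⟨K, hK⟩ := hN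
    exact K.1.interior_nonempty.mono (interior_mono (subset_biUnion_of_mem hK))
  have hcompl : (interior (⋃ L ∈ N, L.1.body)ᶜ).Nonempty := by
    rw [hcompact.isClosed.isOpen_compl.interior_eq, nonempty_compl]
    exact hcompact.ne_univ
  obtain ⟨x, hx, hvertex⟩ := exists_mem_frontier_notMem one_lt_rank_plane
    (finite_range fun z : T.cells × Fin 3 => z.1.1.points z.2).countable hinterior hcompl
  obtain ⟨K, hK, hxK⟩ := mem_iUnion₂.1 (hcompact.isClosed.frontier_subset hx)
  obtain ⟨j, hj⟩ := K.1.exists_mem_openSegment_of_mem_frontier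
    (⟨subset_closure hxK, fun hxint => hx.2 (interior_mono (subset_biUnion_of_mem hK) hxint)⟩)
    fun i hi => hvertex ⟨(K, i), hi.symm⟩
  exact ⟨K, hK, j, x, hj, hx⟩

lemma eq_zero_of_orthogonal_sigmaTilde (hΩ : IsPolygonal Ω) {k : ℕ} (hk : 3 ≤ k)
    {T : Triangulation Ω} {u : VecField T} (hu : ∀ K, IsRigid (u K))
    (h : ∀ τ ∈ SigmaTilde k T, prodVec T (pdiv T τ) u = 0) : u = 0 := by
  by_contra hne
  obtain ⟨K, hK, j, x, hx, hxfrontier⟩ :=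
    T.exists_edge_mem_frontier (N := {K | u K ≠ 0}) (Function.ne_iff.1 hne)
  refine hK ((hu K).eq_zero_of_openSegment (K.1.points_ne j) ?_)
  by_cases hb : ∀ y ∈ openSegment ℝ (K.1.points (j + 1)) (K.1.points (j + 2)), y ∉ Ω
  · exact fun y hy => eq_zero_of_boundary_edge hΩ hk hu h hb hy
  push Not at hb
  obtain ⟨y, hy, hyΩ⟩ := hb
  obtain ⟨L, hLK, l, ho⟩ := T.exists_isOpposite hΩ K hy hyΩ
  have huL : u L = 0 := by
    by_contra hL
    refine hxfrontier.2 (mem_interior_iff_mem_nhds.2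
      (Filter.mem_of_superset (ho.union_body_mem_nhds hx) (union_subset ?_ ?_)))
    · exact subset_biUnion_of_mem (u := fun M : T.cells => M.1.body) hK
    · exact subset_biUnion_of_mem (u := fun M : T.cells => M.1.body) hL
  intro z hz i
  rw [eq_of_interior_edge hΩ hk hu h hLK ho hz, huL, Pi.zero_apply, pval_zero]

lemma eq_zero_of_orthogonal (hΩ : IsPolygonal Ω) {k k' : ℕ} (hk : 3 ≤ k)
    {T : Triangulation Ω} {u : VecField T} (hu : u ∈ DispSpace k k' T)
    (h : ∀ τ ∈ StressSpace k k' T, prodVec T (pdiv T τ) u = 0) : u = 0 := by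
  refine eq_zero_of_orthogonal_sigmaTilde hΩ hk
    (isRigid_of_orthogonal hΩ (by omega) hu h) fun τ hτ => h τ ?_
  rw [← mem_stressSubmodule]
  exact (le_sup_left.trans le_sup_left : sigmaTildeSubmodule k T ≤ _) hτ

/-! ### Stability of the quadrature rule -/

lemma totalDegree_aeval_le {σ τ R : Type*} [CommSemiring R] {f : σ → MvPolynomial τ R}
    (hf : ∀ i, (f i).totalDegree ≤ 1) (p : MvPolynomial σ R) :
    (MvPolynomial.aeval f p).totalDegree ≤ p.totalDegree := by
  rw [MvPolynomial.aeval_def, MvPolynomial.eval₂_eq]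
  refine MvPolynomial.totalDegree_finsetSum_le fun m hm => ?_
  calc _ ≤ _ := MvPolynomial.totalDegree_mul _ _
    _ = (∏ i ∈ m.support, f i ^ m i).totalDegree := by
        rw [MvPolynomial.algebraMap_eq, MvPolynomial.totalDegree_C, zero_add]
    _ ≤ ∑ i ∈ m.support, (f i ^ m i).totalDegree := MvPolynomial.totalDegree_finsetProd _ _
    _ ≤ ∑ i ∈ m.support, m i := Finset.sum_le_sum fun i _ =>
        (MvPolynomial.totalDegree_pow _ _).trans
          ((Nat.mul_le_mul_left _ (hf i)).trans (mul_one _).le)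
    _ ≤ p.totalDegree := MvPolynomial.le_totalDegree hm

namespace Triangle

variable (K : Triangle)

/-- The pull-back of polynomials along `K.fromRef`. -/
def pull : Poly →ₐ[ℝ] Poly :=
  MvPolynomial.aeval fun i => ∑ j, K.points j i • refTriangle.bary j

lemma pval_pull (p : Poly) (x : Plane) : pval (K.pull p) x = pval p (K.fromRef x) := by
  induction p using MvPolynomial.induction_on with
  | C a => simp [pull]
  | add p q hp hq => simp [hp, hq]
  | mul_X p i hp =>
    rw [map_mul, pval_mul, hp, pval_mul]
    simp [pull, fromRef, pointOf, mul_comm]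

lemma totalDegree_pull_le (p : Poly) : (K.pull p).totalDegree ≤ p.totalDegree :=
  totalDegree_aeval_le (fun _ => MvPolynomial.totalDegree_finsetSum_le fun _ _ =>
    totalDegree_smul_le_of_le (refTriangle.totalDegree_bary _) _) p

lemma pull_bary (j : Fin 3) : K.pull (K.bary j) = refTriangle.bary j :=
  MvPolynomial.funext fun y =>
    (K.pval_pull (K.bary j) (WithLp.toLp 2 y)).trans (K.pval_bary_fromRef j _)

lemma pull_mem_Pkk {k k' : ℕ} {p : Poly} (h : p ∈ Pkk k k' K) :
    K.pull p ∈ Pkk k k' refTriangle := by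
  obtain ⟨q, s, hq, hs, rfl⟩ := h
  refine ⟨K.pull q, K.pull s, (K.totalDegree_pull_le q).trans hq,
    (K.totalDegree_pull_le s).trans hs, ?_⟩
  simp only [map_add, map_mul, bubble, K.pull_bary]

lemma area_eq : K.area = |K.det| * refTriangle.area := by
  simpa [area] using K.integral_body fun _ => 1

lemma area_pos : 0 < K.area :=
  ENNReal.toReal_pos ((isOpen_interior.measure_pos volume K.interior_nonempty).trans_le
    (measure_mono interior_subset)).ne' K.isCompact_body.measure_lt_top.ne

end Triangle

/-- The space `P_{k,k'}(K)`. -/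
def pkkSubmodule (k k' : ℕ) (K : Triangle) : Submodule ℝ Poly where
  carrier := Pkk k k' K
  zero_mem' := ⟨0, 0, by simp, by simp, by simp⟩
  add_mem' := by
    rintro _ _ ⟨q, s, hq, hs, rfl⟩ ⟨q', s', hq', hs', rfl⟩
    exact ⟨q + q', s + s', totalDegree_add_le hq hq', totalDegree_add_le hs hs', by ring⟩
  smul_mem' := by
    rintro c _ ⟨q, s, hq, hs, rfl⟩
    exact ⟨c • q, c • s, totalDegree_smul_le_of_le hq c, totalDegree_smul_le_of_le hs c, by
      rw [smul_add, mul_smul_comm]⟩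

namespace LumpingRule

variable {k k' : ℕ} (Q : LumpingRule k k')

/-- The Lagrange basis function of the `i`-th node on the reference triangle. -/
def nodalBasis (i : Fin Q.r) : Poly :=
  (Q.unisolvent (Pi.single i 1)).choose

lemma nodalBasis_mem (i : Fin Q.r) : Q.nodalBasis i ∈ Pkk k k' refTriangle :=
  (Q.unisolvent (Pi.single i 1)).choose_spec.1.1

lemma pval_nodalBasis (i j : Fin Q.r) :
    pval (Q.nodalBasis i) (refTriangle.pointOf (Q.node j)) = (Pi.single i 1 : Fin Q.r → ℝ) j :=
  (Q.unisolvent (Pi.single i 1)).choose_spec.1.2 j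

lemma sum_smul_nodalBasis {p : Poly} (hp : p ∈ Pkk k k' refTriangle) :
    ∑ i, pval p (refTriangle.pointOf (Q.node i)) • Q.nodalBasis i = p := by
  refine (Q.unisolvent fun i => pval p (refTriangle.pointOf (Q.node i))).unique
    ⟨(pkkSubmodule k k' refTriangle).sum_mem fun i _ => Submodule.smul_mem _ _ (Q.nodalBasis_mem i),
      fun i => ?_⟩ ⟨hp, fun _ => rfl⟩
  simp [pval_nodalBasis, Pi.single_apply]

lemma sq_pval_le {p : Poly} (hp : p ∈ Pkk k k' refTriangle) (x : Plane) :
    pval p x ^ 2 ≤ (∑ i, Q.weight i * pval p (refTriangle.pointOf (Q.node i)) ^ 2) *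
      ∑ i, pval (Q.nodalBasis i) x ^ 2 / Q.weight i := by
  nth_rw 1 [← Q.sum_smul_nodalBasis hp]
  simp only [pval_sum, pval_smul]
  refine Finset.sum_sq_le_sum_mul_sum_of_sq_le_mul _
    (fun i _ => mul_nonneg (Q.weight_pos i).le (sq_nonneg _))
    (fun i _ => div_nonneg (sq_nonneg _) (Q.weight_pos i).le) fun i _ => le_of_eq ?_
  have := (Q.weight_pos i).ne'
  field_simp

lemma exists_bound_refTriangle : ∃ C : ℝ, 0 < C ∧
    ∀ p ∈ Pkk k k' refTriangle, ∫ x in refTriangle.body, pval p x ^ 2 ≤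
      C * ∑ i, Q.weight i * pval p (refTriangle.pointOf (Q.node i)) ^ 2 := by
  set D := ∫ x in refTriangle.body, ∑ i, pval (Q.nodalBasis i) x ^ 2 / Q.weight i
  have hD : 0 ≤ D := integral_nonneg fun x => Finset.sum_nonneg fun i _ =>
    div_nonneg (sq_nonneg _) (Q.weight_pos i).le
  have hcont : Continuous fun x => ∑ i, pval (Q.nodalBasis i) x ^ 2 / Q.weight i :=
    continuous_finsetSum _ fun i _ => by fun_prop
  refine ⟨D + 1, by linarith, fun p hp => ?_⟩
  set N := ∑ i, Q.weight i * pval p (refTriangle.pointOf (Q.node i)) ^ 2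
  have hN : 0 ≤ N := Finset.sum_nonneg fun i _ => mul_nonneg (Q.weight_pos i).le (sq_nonneg _)
  calc ∫ x in refTriangle.body, pval p x ^ 2
      ≤ ∫ x in refTriangle.body, N * ∑ i, pval (Q.nodalBasis i) x ^ 2 / Q.weight i :=
        integral_mono (refTriangle.integrableOn_body (by fun_prop))
          (refTriangle.integrableOn_body (hcont.const_mul _)) (Q.sq_pval_le hp)
    _ = D * N := by rw [integral_const_mul, mul_comm]
    _ ≤ (D + 1) * N := mul_le_mul_of_nonneg_right (by linarith) hN

lemma exists_bound : ∃ C : ℝ, 0 < C ∧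
    ∀ K : Triangle, ∀ p ∈ Pkk k k' K, ∫ x in K.body, pval p x ^ 2 ≤
      C * Q.quad K fun x => pval p x ^ 2 := by
  obtain ⟨C, hC, h⟩ := Q.exists_bound_refTriangle
  have hr := refTriangle.area_pos
  refine ⟨C / refTriangle.area, div_pos hC hr, fun K p hp => ?_⟩
  have hpull := h _ (K.pull_mem_Pkk hp)
  simp only [K.pval_pull, K.fromRef_pointOf (Q.node_sum _)] at hpull
  calc ∫ x in K.body, pval p x ^ 2
      = |K.det| * ∫ x in refTriangle.body, pval p (K.fromRef x) ^ 2 := K.integral_body _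
    _ ≤ |K.det| * (C * ∑ i, Q.weight i * pval p (K.pointOf (Q.node i)) ^ 2) :=
        mul_le_mul_of_nonneg_left hpull (abs_nonneg _)
    _ = C / refTriangle.area * Q.quad K fun x => pval p x ^ 2 := by
        simp only [quad, K.area_eq, mul_assoc, ← Finset.mul_sum]
        field_simp

end LumpingRule

/-! ### Coercivity -/

lemma ddot_self_le_compliance {lam mu : ℝ} (hmu : 0 < mu) (hlam : 0 < mu + lam)
    (A : Matrix (Fin 2) (Fin 2) ℝ) :
    ddot A A ≤ 2 * (2 * mu + lam) * ddot (compliance lam mu A) A := by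
  have hmu' := hmu.ne'
  have hgap : 2 * (2 * mu + lam) * ddot (compliance lam mu A) A - ddot A A =
      (mu + lam) / mu * ((A 0 0 - A 1 1) ^ 2 / 2 + A 0 1 ^ 2 + A 1 0 ^ 2) +
        mu / (mu + lam) * ((A 0 0 + A 1 1) ^ 2 / 2) := by
    have hlam'' := hlam.ne'
    simp only [ddot, compliance, Fin.sum_univ_two, Matrix.smul_apply, Matrix.sub_apply,
      Matrix.trace_fin_two, Matrix.one_apply, smul_eq_mul]
    simp
    field_simp
    ring
  rw [← sub_nonneg, hgap]
  positivity

lemma ddot_self_nonneg (A : Matrix (Fin 2) (Fin 2) ℝ) : 0 ≤ ddot A A :=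
  Finset.sum_nonneg fun _ _ => Finset.sum_nonneg fun _ _ => mul_self_nonneg _

lemma normMat_sq (hΩ : IsPolygonal Ω) (T : Triangulation Ω) (τ : MatField T) :
    normMat Ω (matFun T τ) ^ 2 =
      ∑ K : T.cells, ∑ i, ∑ j, ∫ x in K.1.body, pval (τ K i j) x ^ 2 := by
  rw [normMat, Real.sq_sqrt (integral_nonneg fun x => ddot_self_nonneg _),
    T.integral_eq_sum hΩ (g := fun K x => ∑ i, ∑ j, pval (τ K i j) x ^ 2) (fun K => by fun_prop)
      fun K x hx => by simp only [ddot, matFun_apply, scalFun_eq T _ K hx, pow_two]]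
  refine Finset.sum_congr rfl fun K _ => ?_
  rw [integral_finsetSum _ fun i _ => K.1.integrableOn_body (by fun_prop)]
  exact Finset.sum_congr rfl fun i _ =>
    integral_finsetSum _ fun j _ => K.1.integrableOn_body (by fun_prop)

lemma eq_zero_of_normMat (hΩ : IsPolygonal Ω) (T : Triangulation Ω) {τ : MatField T}
    (h : normMat Ω (matFun T τ) = 0) : τ = 0 := by
  have hsum := normMat_sq hΩ T τ
  simp only [h, ← Fintype.sum_prod_type'] at hsum
  rw [zero_pow two_ne_zero, eq_comm,
    Finset.sum_eq_zero_iff_of_nonneg fun _ _ => integral_nonneg fun _ => sq_nonneg _] at hsum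
  ext1 K
  ext1 i j
  have hKij := hsum (K, i, j) (Finset.mem_univ _)
  simp only [← pval_pow] at hKij
  exact pow_eq_zero_iff two_ne_zero |>.1
    (K.1.integral_pval_eq_zero (fun x _ => by rw [pval_pow]; exact sq_nonneg _) hKij)

lemma LumpingRule.exists_coercive {k k' : ℕ} (Q : LumpingRule k k') {lam mu : ℝ} (hmu : 0 < mu)
    (hlam : 0 < mu + lam) : ∃ C : ℝ, 0 < C ∧ ∀ Ω : Set Plane, IsPolygonal Ω →
      ∀ T : Triangulation Ω, ∀ τ ∈ StressSpace k k' T,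
        C * normMat Ω (matFun T τ) ^ 2 ≤ lumped Q lam mu T τ τ := by
  obtain ⟨C, hC, h⟩ := Q.exists_bound
  have hM : 0 < C * (2 * (2 * mu + lam)) := mul_pos hC (by linarith)
  refine ⟨(C * (2 * (2 * mu + lam)))⁻¹, inv_pos.2 hM, fun Ω hΩ T τ hτ => ?_⟩
  rw [inv_mul_le_iff₀ hM, normMat_sq hΩ, lumped, Finset.mul_sum]
  refine Finset.sum_le_sum fun K _ => ?_
  calc ∑ i, ∑ j, ∫ x in K.1.body, pval (τ K i j) x ^ 2
      ≤ ∑ i, ∑ j, C * Q.quad K.1 fun x => pval (τ K i j) x ^ 2 :=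
        Finset.sum_le_sum fun i _ => Finset.sum_le_sum fun j _ =>
          h K.1 _ (StressSpace.mem_Pkk hτ K i j)
    _ = C * ∑ n, (K.1.area * Q.weight n) *
          ddot (mval (τ K) (K.1.pointOf (Q.node n))) (mval (τ K) (K.1.pointOf (Q.node n))) := by
        simp only [LumpingRule.quad, ddot, mval, Matrix.of_apply, Fin.sum_univ_two,
          ← Finset.mul_sum, ← Finset.sum_add_distrib, ← mul_add, pow_two]
    _ ≤ C * ∑ n, (K.1.area * Q.weight n) * (2 * (2 * mu + lam) *
          ddot (compliance lam mu (mval (τ K) (K.1.pointOf (Q.node n))))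
            (mval (τ K) (K.1.pointOf (Q.node n)))) :=
        mul_le_mul_of_nonneg_left (Finset.sum_le_sum fun n _ =>
          mul_le_mul_of_nonneg_left (ddot_self_le_compliance hmu hlam _)
            (mul_nonneg K.1.area_pos.le (Q.weight_pos n).le)) hC.le
    _ = _ := by
        simp only [LumpingRule.quad, Finset.mul_sum]
        exact Finset.sum_congr rfl fun n _ => by ring

/-! ### The saddle point problem -/

lemma ddot_add_left (A A' B : Matrix (Fin 2) (Fin 2) ℝ) :
    ddot (A + A') B = ddot A B + ddot A' B := by
  simp only [ddot, Matrix.add_apply, add_mul, Finset.sum_add_distrib]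

lemma ddot_add_right (A B B' : Matrix (Fin 2) (Fin 2) ℝ) :
    ddot A (B + B') = ddot A B + ddot A B' := by
  simp only [ddot, Matrix.add_apply, mul_add, Finset.sum_add_distrib]

lemma ddot_smul_left (c : ℝ) (A B : Matrix (Fin 2) (Fin 2) ℝ) :
    ddot (c • A) B = c * ddot A B := by
  simp only [ddot, Matrix.smul_apply, smul_eq_mul, mul_assoc, Finset.mul_sum]

lemma ddot_smul_right (c : ℝ) (A B : Matrix (Fin 2) (Fin 2) ℝ) :
    ddot A (c • B) = c * ddot A B := by
  simp only [ddot, Matrix.smul_apply, smul_eq_mul, mul_left_comm _ c, Finset.mul_sum]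

lemma compliance_add (lam mu : ℝ) (A B : Matrix (Fin 2) (Fin 2) ℝ) :
    compliance lam mu (A + B) = compliance lam mu A + compliance lam mu B := by
  simp only [compliance, Matrix.trace_add, mul_add, add_smul, ← smul_add, add_sub_add_comm]

lemma compliance_smul (lam mu c : ℝ) (A : Matrix (Fin 2) (Fin 2) ℝ) :
    compliance lam mu (c • A) = c • compliance lam mu A := by
  simp only [compliance, Matrix.trace_smul, smul_eq_mul, mul_left_comm _ c]
  rw [mul_smul c, ← smul_sub, smul_comm]

section Quadrature

variable {k k' : ℕ} (Q : LumpingRule k k') (K : Triangle)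

lemma LumpingRule.quad_add (f g : Plane → ℝ) :
    Q.quad K (fun x => f x + g x) = Q.quad K f + Q.quad K g := by
  simp only [quad, mul_add, Finset.sum_add_distrib]

lemma LumpingRule.quad_const_mul (c : ℝ) (f : Plane → ℝ) :
    Q.quad K (fun x => c * f x) = c * Q.quad K f := by
  simp only [quad, Finset.mul_sum, mul_left_comm _ c]

end Quadrature

/-- The form `(𝒜σ, τ)_h` as a bilinear map on piecewise polynomial fields. -/
def lumpedBilin {k k' : ℕ} (Q : LumpingRule k k') (lam mu : ℝ) (T : Triangulation Ω) :
    MatField T →ₗ[ℝ] MatField T →ₗ[ℝ] ℝ :=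
  LinearMap.mk₂ ℝ (lumped Q lam mu T)
    (fun σ σ' τ => by
      simp only [lumped, Pi.add_apply, mval_add, compliance_add, ddot_add_left, Q.quad_add,
        Finset.sum_add_distrib])
    (fun c σ τ => by
      simp only [lumped, Pi.smul_apply, mval_smul, compliance_smul, ddot_smul_left,
        Q.quad_const_mul, Finset.mul_sum, smul_eq_mul])
    (fun σ τ τ' => by
      simp only [lumped, Pi.add_apply, mval_add, ddot_add_right, Q.quad_add,
        Finset.sum_add_distrib])
    (fun c σ τ => by
      simp only [lumped, Pi.smul_apply, mval_smul, ddot_smul_right,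
        Q.quad_const_mul, Finset.mul_sum, smul_eq_mul])

section Saddle

variable {𝕜 V W : Type*} [Field 𝕜] [AddCommGroup V] [Module 𝕜 V] [AddCommGroup W] [Module 𝕜 W]
  (a : V →ₗ[𝕜] V →ₗ[𝕜] 𝕜) (b : V →ₗ[𝕜] W →ₗ[𝕜] 𝕜)

lemma existsUnique_saddle [Module.Finite 𝕜 V] [Module.Finite 𝕜 W]
    (ha : ∀ σ, a σ σ = 0 → σ = 0) (hb : ∀ u, (∀ τ, b τ u = 0) → u = 0) (F : W →ₗ[𝕜] 𝕜) :
    ∃! s : V × W, (∀ τ, a s.1 τ + b τ s.2 = 0) ∧ ∀ v, - b s.1 v = F v := by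
  let A : V × W →ₗ[𝕜] Module.Dual 𝕜 V × Module.Dual 𝕜 W :=
    (a.coprod b.flip).prod ((-b).comp (LinearMap.fst 𝕜 V W))
  have hA (s : V × W) (G : Module.Dual 𝕜 W) : A s = (0, G) ↔
      (∀ τ, a s.1 τ + b τ s.2 = 0) ∧ ∀ v, - b s.1 v = G v := by
    simp [A, Prod.ext_iff, LinearMap.ext_iff]
  have hinj : Function.Injective A := by
    rw [injective_iff_map_eq_zero]
    rintro ⟨σ, u⟩ hs
    obtain ⟨hV, hW⟩ := (hA (σ, u) 0).1 hs
    have hσu : b σ u = 0 := neg_eq_zero.1 (hW u)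
    obtain rfl : σ = 0 := ha σ (by simpa only [hσu, add_zero] using hV σ)
    obtain rfl : u = 0 := hb u fun τ => by simpa using hV τ
    rfl
  have hdim : Module.finrank 𝕜 (V × W) =
      Module.finrank 𝕜 (Module.Dual 𝕜 V × Module.Dual 𝕜 W) := by
    simp only [Module.finrank_prod, Subspace.dual_finrank_eq]
  obtain ⟨s, hs⟩ :=
    (LinearMap.injective_iff_surjective_of_finrank_eq_finrank hdim).1 hinj (0, F)
  exact ⟨s, (hA s F).1 hs, fun s' hs' => hinj (((hA s' F).2 hs').trans hs.symm)⟩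

lemma existsUnique_saddle_submodule (S : Submodule 𝕜 V) [Module.Finite 𝕜 S]
    (D : Submodule 𝕜 W) [Module.Finite 𝕜 D] (ha : ∀ σ ∈ S, a σ σ = 0 → σ = 0)
    (hb : ∀ u ∈ D, (∀ τ ∈ S, b τ u = 0) → u = 0) (F : W →ₗ[𝕜] 𝕜) :
    ∃! s : V × W, (s.1 ∈ S ∧ s.2 ∈ D) ∧ (∀ τ ∈ S, a s.1 τ + b τ s.2 = 0) ∧
      ∀ v ∈ D, - b s.1 v = F v := by
  obtain ⟨⟨σ, u⟩, ⟨hV, hW⟩, huniq⟩ := existsUnique_saddle (a.domRestrict₁₂ S S)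
    (b.domRestrict₁₂ S D) (fun σ hσ => Subtype.ext (ha σ σ.2 hσ))
    (fun u hu => Subtype.ext (hb u u.2 fun τ hτ => hu ⟨τ, hτ⟩)) (F.domRestrict D)
  refine ⟨(σ, u), ⟨⟨σ.2, u.2⟩, fun τ hτ => hV ⟨τ, hτ⟩, fun v hv => hW ⟨v, hv⟩⟩, ?_⟩
  rintro ⟨σ', u'⟩ ⟨⟨hσ', hu'⟩, hV', hW'⟩
  have h := huniq (⟨σ', hσ'⟩, ⟨u', hu'⟩) ⟨fun τ => hV' τ τ.2, fun v => hW' v v.2⟩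
  exact Prod.ext (congrArg (fun s => s.1.1) h) (congrArg (fun s => s.2.1) h)

end Saddle

/-- The load functional `v ↦ (f, v)` on piecewise polynomial displacements. -/
def loadLin (T : Triangulation Ω) {f : Plane → Fin 2 → ℝ} (hf : MemL2Vec Ω f) :
    VecField T →ₗ[ℝ] ℝ where
  toFun v := innerVec Ω f (vecFun T v)
  map_add' v w := by
    have hintegrable (v : VecField T) : Integrable (fun x => ∑ i, f x i * vecFun T v x i)
        (volume.restrict Ω) :=
      integrable_finsetSum _ fun i _ => MemLp.integrable_mul (hf i) (memL2Vec_vecFun T Ω v i)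
    simp only [innerVec, vecFun_add, Pi.add_apply, mul_add, Finset.sum_add_distrib]
    exact integral_add (hintegrable v) (hintegrable w)
  map_smul' c v := by
    simp only [innerVec, vecFun_smul, Pi.smul_apply, smul_eq_mul, mul_left_comm _ c,
      ← Finset.mul_sum, integral_const_mul, RingHom.id_apply]

section Solvability

variable {k k' : ℕ} (Q : LumpingRule k k') (T : Triangulation Ω) {f : Plane → Fin 2 → ℝ}

lemma isLumpedSolution_iff (hΩ : IsPolygonal Ω) (lam mu : ℝ) (hf : MemL2Vec Ω f)
    (σ : MatField T) (u : VecField T) : IsLumpedSolution Q lam mu T f σ u ↔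
      (σ ∈ stressSubmodule k k' T ∧ u ∈ dispSubmodule k k' T) ∧
      (∀ τ ∈ stressSubmodule k k' T,
        lumpedBilin Q lam mu T σ τ + (prodVec T).comp (pdivLin T) τ u = 0) ∧
      ∀ v ∈ dispSubmodule k k' T, - (prodVec T).comp (pdivLin T) σ v = loadLin T hf v := by
  have hdiv {τ : MatField T} (hτ : τ ∈ StressSpace k k' T) (v : VecField T) :
      innerVec Ω (weakDiv Ω (matFun T τ)) (vecFun T v) = (prodVec T).comp (pdivLin T) τ v :=
    innerVec_weakDiv hΩ (StressSpace.memHDiv hτ) v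
  simp only [mem_stressSubmodule, mem_dispSubmodule hΩ]
  constructor
  · intro h
    refine ⟨⟨h.stress_mem, h.displacement_mem⟩, fun τ hτ => ?_, fun v hv => ?_⟩
    · rw [← hdiv hτ]
      exact h.constitutive τ hτ
    · rw [← hdiv h.stress_mem]
      exact h.equilibrium v hv
  · rintro ⟨⟨hσ, hu⟩, hconst, hequil⟩
    refine ⟨hσ, hu, fun τ hτ => ?_, fun v hv => ?_⟩
    · rw [hdiv hτ]
      exact hconst τ hτ
    · rw [hdiv hσ]
      exact hequil v hv

lemma existsUnique_isLumpedSolution (hΩ : IsPolygonal Ω) (hk : 3 ≤ k) {lam mu : ℝ} (hmu : 0 < mu)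
    (hlam : 0 < mu + lam) (hf : MemL2Vec Ω f) :
    ∃! s : MatField T × VecField T, IsLumpedSolution Q lam mu T f s.1 s.2 := by
  obtain ⟨C, hC, hcoer⟩ := Q.exists_coercive hmu hlam
  simp only [isLumpedSolution_iff Q T hΩ lam mu hf]
  refine existsUnique_saddle_submodule _ _ _ _ (fun σ hσ hσσ => ?_) (fun u hu hdiv => ?_) _
  · have hnorm : C * normMat Ω (matFun T σ) ^ 2 ≤ 0 :=
      (hcoer Ω hΩ T σ (mem_stressSubmodule.1 hσ)).trans_eq hσσ
    exact eq_zero_of_normMat hΩ T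
      (pow_eq_zero_iff two_ne_zero |>.1 (le_antisymm (nonpos_of_mul_nonpos_right hnorm hC)
        (sq_nonneg _)))
  · exact eq_zero_of_orthogonal hΩ hk ((mem_dispSubmodule hΩ).1 hu)
      fun τ hτ => hdiv τ (mem_stressSubmodule.2 hτ)

end Solvability

end LumpedElasticity

end

open LumpedElasticity in
theorem lemma4p1_general (k k' : ℕ) (hk : 3 ≤ k) (Q : LumpingRule k k') (lam mu : ℝ)
    (hmu : 0 < mu) (hlam : 0 < mu + lam) :
    (∃ C : ℝ, 0 < C ∧ ∀ Ω : Set Plane, IsPolygonal Ω → ∀ T : Triangulation Ω,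
      ∀ τ ∈ StressSpace k k' T,
        C * normMat Ω (matFun T τ) ^ 2 ≤ lumped Q lam mu T τ τ) ∧
    (∀ Ω : Set Plane, IsPolygonal Ω → ∀ T : Triangulation Ω,
      ∀ f : Plane → Fin 2 → ℝ, MemL2Vec Ω f →
        ∃! s : MatField T × VecField T, IsLumpedSolution Q lam mu T f s.1 s.2) :=
  ⟨Q.exists_coercive hmu hlam, fun _ hΩ T _ hf =>
    existsUnique_isLumpedSolution Q T hΩ hk hmu hlam hf⟩

open LumpedElasticity in
theorem lemma4p1 (k k' : ℕ) (hk : 3 ≤ k) (hkk' : k < k') (Q : LumpingRule k k')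
    (lam mu : ℝ) (hlam : 0 < lam) (hmu : 0 < mu) :
    (∃ C : ℝ, 0 < C ∧ ∀ Ω : Set Plane, IsPolygonal Ω → ∀ T : Triangulation Ω,
      ∀ τ ∈ StressSpace k k' T,
        C * normMat Ω (matFun T τ) ^ 2 ≤ lumped Q lam mu T τ τ) ∧
    (∀ Ω : Set Plane, IsPolygonal Ω → ∀ T : Triangulation Ω,
      ∀ f : Plane → Fin 2 → ℝ, MemL2Vec Ω f →
        ∃! s : MatField T × VecField T, IsLumpedSolution Q lam mu T f s.1 s.2) :=
  lemma4p1_general k k' hk Q lam mu hmu (add_pos hmu hlam)
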